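/- All graphs are finite. For real numbers $a>0$ and $b$, a simple graph $G$ is \emph{$(a,b)$-sparse} if for every $A\subseteq V(G)$ with $|A|\ge 2$ the induced subgraph $G[A]$ has at most $a|A|+b$ edges. For an integer $D\ge 0$, an \emph{$(\mathcal F_D,\mathcal F)$-coloring} of $G$ is a partition $(M,F)$ of $V(G)$ into two (possibly empty) sets such that $G[M]$ is a forest of maximum degree at most $D$ and $G[F]$ is a forest. Let $D\ge 2$ be an integer, and put $a_D=\frac{6D+5}{3(D+1)}$ and $b_D=\frac{2}{3(D+1)}$. (1) Every $(a_D,b_D)$-sparse simple graph has an $(\mathcal F_D,\mathcal F)$-coloring. (2) The bound is exact: for all real $a\ge a_D$ and $b\ge b_D$, every $(a,b)$-sparse simple graph has an $(\mathcal F_D,\mathcal F)$-coloring if and only if $a=a_D$ and $b<\frac{1}{D+1}=b_D+\frac{1}{3(D+1)}$. (For $b_D\le b<\frac1{D+1}$, being $(a_D,b)$-sparse is the same as being $(a_D,b_D)$-sparse, because numbers of vertices and edges are integers.) (3) Moreover, there are arbitrarily large simple graphs $G$ without an $(\mathcal F_D,\mathcal F)$-coloring that are $\left(a_D,\frac{1}{D+1}\right)$-sparse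 and satisfy $|E(G)|=a_D|V(G)|+\frac{1}{D+1}=\frac{(6D+5)|V(G)|+3}{3(D+1)}$. -/

import Mathlib

universe u

/-- A (finite) simple graph `G` is `(a, b)`-sparse if every vertex set `A` with `|A| ≥ 2` induces a
subgraph with at most `a |A| + b` edges. -/
def SimpleGraph.IsABSparse {V : Type u} (G : SimpleGraph V) (a b : ℝ) : Prop :=
  ∀ A : Finset V, 2 ≤ A.card →
    ((G.induce (A : Set V)).edgeSet.ncard : ℝ) ≤ a * (A.card : ℝ) + b

/-- An `(F_D, F)`-coloring of `G`: a partition `(M, F)` of the vertex set such that `G[M]` is a forest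
of maximum degree at most `D` and `G[F]` is a forest. Either part may be empty. -/
structure SimpleGraph.IsForestColoring {V : Type u} (G : SimpleGraph V) (D : ℕ) (M F : Set V) :
    Prop where
  disjoint : Disjoint M F
  union_eq : M ∪ F = Set.univ
  forest_left : (G.induce M).IsAcyclic
  degree_le : ∀ v : M, ((G.induce M).neighborSet v).encard ≤ (D : ℕ∞)
  forest_right : (G.induce F).IsAcyclic

/-- `G` has an `(F_D, F)`-coloring. -/
def SimpleGraph.HasForestColoring {V : Type u} (G : SimpleGraph V) (D : ℕ) : Prop :=
  ∃ M F : Set V, G.IsForestColoring D M F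

set_option linter.unusedSectionVars false

namespace ForestColoring

open Finset

/-! ### Edge counts, potential and forests as integer inequalities. -/

section Counting

variable {V : Type*} [DecidableEq V]

/-! Put k = D + 1 and give each vertex v a capacity c v in [0, k]: its degree in M must stay below c
v, so capacity 0 forces v into F. For constant capacity k, the edge bound multiplied by 3k says that
every subset has potential at least -2. Variable capacities make induction possible: losing one unit
at a vertex costs potential 3, while an edge is worth 3k, so one edge into M pays for the loss of a
whole capacity.

For colourability (`colorable_of_sparse`), consider a smallest uncolourable sparse set S. A proper
subset A of small potential can be coloured first and replaced by an edge of capacity-0 vertices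
that records the effect of its F-part, while outside neighbours of its M-part lose capacity
(`colorable_of_contract`). Gluing the colourings back gives potential at least 1, and then at least
4, for proper nonempty subsets (`one_le_pot_of_not_colorable`, `four_le_pot_of_not_colorable`). This
leaves room to reserve places at the neighbours of a deleted vertex, and yields degree at least 2,
3, 4 at capacity 0, 1, at least 2 (`charge_le_of_not_colorable`). Each vertex then contributes at
most -2 to twice the potential of S. As the potential is at least -2, S has at most two vertices,
against the existence of a vertex of degree 2.

For sharpness, a triangle of capacity 0 is uncolourable with potential -3. Raising the capacity of x
by one and attaching a new triangle to x preserves both properties (`Tight.addTriangle`): the new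
triangle cannot lie in F, and its vertex in M uses up the extra unit if x is in M. Such steps first
enlarge the graph and then bring all capacities to k (`exists_full_tight`). Only the full vertex set
violates sparsity, and by the least amount. -/

open scoped Classical in
/-- The adjacency indicator of `G`. -/
noncomputable def adjI (G : SimpleGraph V) (u v : V) : ℤ := if G.Adj u v then 1 else 0

/-- The number of neighbours of `v` in `S`. -/
noncomputable def degIn (G : SimpleGraph V) (S : Finset V) (v : V) : ℤ := ∑ u ∈ S, adjI G v u

/-- The number of edges between `S` and `T`, for disjoint `S` and `T`. -/
noncomputable def cross (G : SimpleGraph V) (S T : Finset V) : ℤ := ∑ u ∈ S, degIn G T u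

/-- The number of edges inside `S`. -/
noncomputable def edgesIn (G : SimpleGraph V) (S : Finset V) : ℤ := cross G S S / 2

/-- The potential of `S` with respect to the capacities `c`. -/
noncomputable def pot (k : ℤ) (G : SimpleGraph V) (c : V → ℤ) (S : Finset V) : ℤ :=
  ∑ v ∈ S, (3 * k - 1 + 3 * c v) - 3 * k * edgesIn G S

/-- Forests, in counting form: every nonempty subset `T` spans at most `|T| - 1` edges. -/
def Forest (G : SimpleGraph V) (S : Finset V) : Prop :=
  ∀ T ⊆ S, T.Nonempty → edgesIn G T + 1 ≤ T.card

/-- `S` is split into forests `M` and `F` such that every `v ∈ M` has fewer than `c v` neighbours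
in `M`. -/
structure IsCapColoring (G : SimpleGraph V) (c : V → ℤ) (S M F : Finset V) : Prop where
  disj : Disjoint M F
  union : M ∪ F = S
  forestM : Forest G M
  forestF : Forest G F
  deg : ∀ v ∈ M, degIn G M v + 1 ≤ c v

/-- Every subset of `S` has potential at least `-2`. -/
def Sparse (k : ℤ) (G : SimpleGraph V) (c : V → ℤ) (S : Finset V) : Prop :=
  ∀ A ⊆ S, -2 ≤ pot k G c A

variable {G : SimpleGraph V}

lemma adjI_of_adj {u v : V} (h : G.Adj u v) : adjI G u v = 1 := if_pos h

lemma adjI_of_not_adj {u v : V} (h : ¬ G.Adj u v) : adjI G u v = 0 := if_neg h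

lemma adjI_nonneg (u v : V) : 0 ≤ adjI G u v := by
  unfold adjI; split_ifs <;> norm_num

lemma adjI_le_one (u v : V) : adjI G u v ≤ 1 := by
  unfold adjI; split_ifs <;> norm_num

lemma adjI_congr {W : Type*} [DecidableEq W] {H : SimpleGraph W} {u v : V} {u' v' : W}
    (h : G.Adj u v ↔ H.Adj u' v') : adjI G u v = adjI H u' v' := by
  by_cases hu : G.Adj u v
  · rw [adjI_of_adj hu, adjI_of_adj (h.1 hu)]
  · rw [adjI_of_not_adj hu, adjI_of_not_adj fun h' => hu (h.2 h')]

lemma adjI_comm (u v : V) : adjI G u v = adjI G v u := adjI_congr (G.adj_comm u v)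

lemma adjI_self (u : V) : adjI G u u = 0 := adjI_of_not_adj (G.loopless.irrefl u)

lemma degIn_nonneg (S : Finset V) (v : V) : 0 ≤ degIn G S v :=
  sum_nonneg fun _ _ => adjI_nonneg _ _

lemma degIn_mono {S T : Finset V} (h : S ⊆ T) (v : V) : degIn G S v ≤ degIn G T v :=
  sum_le_sum_of_subset_of_nonneg h fun _ _ _ => adjI_nonneg _ _

lemma degIn_union {S T : Finset V} (h : Disjoint S T) (v : V) :
    degIn G (S ∪ T) v = degIn G S v + degIn G T v := sum_union h

@[simp] lemma degIn_empty (v : V) : degIn G ∅ v = 0 := rfl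

@[simp] lemma degIn_singleton (u v : V) : degIn G {u} v = adjI G v u := sum_singleton _ _

lemma degIn_pair {a b : V} (h : a ≠ b) (v : V) :
    degIn G {a, b} v = adjI G v a + adjI G v b := sum_pair h

lemma degIn_eq_zero {S : Finset V} {v : V} (h : ∀ u ∈ S, ¬ G.Adj v u) : degIn G S v = 0 :=
  sum_eq_zero fun u hu => adjI_of_not_adj (h u hu)

lemma exists_adj_of_degIn_ne_zero {S : Finset V} {v : V} (h : degIn G S v ≠ 0) :
    ∃ u ∈ S, G.Adj v u := by
  by_contra! hc
  exact h (degIn_eq_zero hc)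

lemma one_le_degIn {S : Finset V} {v u : V} (hu : u ∈ S) (h : G.Adj v u) : 1 ≤ degIn G S v := by
  have := degIn_mono (G := G) (singleton_subset_iff.2 hu) v
  rwa [degIn_singleton, adjI_of_adj h] at this

lemma degIn_le_one {S : Finset V} {v x : V} (h : ∀ u ∈ S, G.Adj v u → u = x) :
    degIn G S v ≤ 1 := by
  by_cases h0 : degIn G S v = 0
  · omega
  obtain ⟨u, hu, hvu⟩ := exists_adj_of_degIn_ne_zero h0
  have hx := h u hu hvu
  subst hx
  unfold degIn
  rw [sum_eq_single_of_mem u hu fun b hb hbu => adjI_of_not_adj fun hab => hbu (h b hb hab)]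
  exact adjI_le_one _ _

lemma cross_comm (S T : Finset V) : cross G S T = cross G T S := by
  unfold cross degIn
  rw [sum_comm]
  simp only [adjI_comm]

lemma cross_union_left {S T U : Finset V} (h : Disjoint S T) :
    cross G (S ∪ T) U = cross G S U + cross G T U := sum_union h

lemma cross_union_right {S T U : Finset V} (h : Disjoint S T) :
    cross G U (S ∪ T) = cross G U S + cross G U T := by
  rw [cross_comm, cross_union_left h, cross_comm S, cross_comm T]

lemma cross_singleton_left (v : V) (S : Finset V) : cross G {v} S = degIn G S v :=
  sum_singleton _ _

lemma cross_mono {S S' T T' : Finset V} (hS : S ⊆ S') (hT : T ⊆ T') :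
    cross G S T ≤ cross G S' T' :=
  (sum_le_sum fun _ _ => degIn_mono hT _).trans
    (sum_le_sum_of_subset_of_nonneg hS fun _ _ _ => degIn_nonneg _ _)

lemma cross_self_even (S : Finset V) : Even (cross G S S) := by
  induction S using Finset.induction_on with
  | empty => exact ⟨0, rfl⟩
  | insert v S hv ih =>
    have hd : Disjoint {v} S := disjoint_singleton_left.2 hv
    rw [insert_eq, cross_union_left hd, cross_union_right hd, cross_union_right hd,
      cross_comm S {v}, cross_singleton_left, cross_singleton_left, degIn_singleton, adjI_self]
    obtain ⟨r, hr⟩ := ih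
    exact ⟨degIn G S v + r, by rw [hr]; ring⟩

lemma two_mul_edgesIn (S : Finset V) : 2 * edgesIn G S = cross G S S :=
  Int.two_mul_ediv_two_of_even (cross_self_even S)

lemma edgesIn_union {S T : Finset V} (h : Disjoint S T) :
    edgesIn G (S ∪ T) = edgesIn G S + edgesIn G T + cross G S T := by
  have h1 := two_mul_edgesIn (G := G) (S ∪ T)
  rw [cross_union_left h, cross_union_right h, cross_union_right h, cross_comm T S] at h1
  have h2 := two_mul_edgesIn (G := G) S
  have h3 := two_mul_edgesIn (G := G) T
  linarith

@[simp] lemma edgesIn_empty : edgesIn G ∅ = 0 := rfl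

@[simp] lemma edgesIn_singleton (v : V) : edgesIn G {v} = 0 := by
  have h := two_mul_edgesIn (G := G) {v}
  rw [cross_singleton_left, degIn_singleton, adjI_self] at h
  linarith

lemma edgesIn_insert {S : Finset V} {v : V} (h : v ∉ S) :
    edgesIn G (insert v S) = edgesIn G S + degIn G S v := by
  rw [insert_eq, edgesIn_union (disjoint_singleton_left.2 h), edgesIn_singleton,
    cross_singleton_left, zero_add]

lemma edgesIn_pair {a b : V} (h : a ≠ b) : edgesIn G {a, b} = adjI G a b := by
  rw [edgesIn_insert (by simpa using h), edgesIn_singleton, degIn_singleton, zero_add]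

variable {k : ℤ} {c : V → ℤ}

lemma pot_union {S T : Finset V} (h : Disjoint S T) :
    pot k G c (S ∪ T) = pot k G c S + pot k G c T - 3 * k * cross G S T := by
  unfold pot
  rw [sum_union h, edgesIn_union h]
  ring

@[simp] lemma pot_empty : pot k G c ∅ = 0 := by simp [pot]

@[simp] lemma pot_singleton (v : V) : pot k G c {v} = 3 * k - 1 + 3 * c v := by simp [pot]

lemma pot_pair {a b : V} (h : a ≠ b) :
    pot k G c {a, b} = 6 * k - 2 + 3 * c a + 3 * c b - 3 * k * adjI G a b := by
  unfold pot
  rw [sum_pair h, edgesIn_pair h]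
  ring

lemma pot_insert {S : Finset V} {v : V} (h : v ∉ S) :
    pot k G c (insert v S) = pot k G c S + (3 * k - 1 + 3 * c v) - 3 * k * degIn G S v := by
  rw [insert_eq, pot_union (disjoint_singleton_left.2 h), pot_singleton, cross_singleton_left]
  ring

lemma pot_change_cap (c' : V → ℤ) (S : Finset V) :
    pot k G c' S = pot k G c S - 3 * ∑ v ∈ S, (c v - c' v) := by
  unfold pot
  rw [mul_sum, sub_right_comm, ← sum_sub_distrib]
  congr 1
  exact sum_congr rfl fun v _ => by ring

lemma two_mul_pot (S : Finset V) :
    2 * pot k G c S = ∑ v ∈ S, (6 * k - 2 + 6 * c v - 3 * k * degIn G S v) := by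
  have h := two_mul_edgesIn (G := G) S
  unfold pot
  rw [sum_sub_distrib, ← mul_sum]
  change _ = _ - 3 * k * cross G S S
  rw [← h, mul_sub, mul_sum]
  have : ∀ v ∈ S, 2 * (3 * k - 1 + 3 * c v) = 6 * k - 2 + 6 * c v := fun v _ => by ring
  rw [sum_congr rfl this]
  ring

lemma Forest.mono {S T : Finset V} (h : Forest G T) (hST : S ⊆ T) : Forest G S :=
  fun U hU => h U (hU.trans hST)

lemma Forest.empty : Forest G (∅ : Finset V) := fun T hT hne => by
  rw [subset_empty.1 hT] at hne
  exact absurd hne not_nonempty_empty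

lemma Forest.union {S T : Finset V} (hS : Forest G S) (hT : Forest G T) (hd : Disjoint S T)
    (hc : cross G S T ≤ 1) : Forest G (S ∪ T) := by
  intro U hU hne
  have hUe : U = (U ∩ S) ∪ (U ∩ T) := by
    rw [← inter_union_distrib_left, inter_eq_left.2 hU]
  have hd' : Disjoint (U ∩ S) (U ∩ T) := hd.mono inter_subset_right inter_subset_right
  have hcr := cross_mono (G := G) (inter_subset_right (s₁ := U) (s₂ := S))
    (inter_subset_right (s₁ := U) (s₂ := T))
  rcases (U ∩ S).eq_empty_or_nonempty with h1 | h1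
  · rw [h1, empty_union] at hUe
    exact hT U (hUe ▸ inter_subset_right) hne
  rcases (U ∩ T).eq_empty_or_nonempty with h2 | h2
  · rw [h2, union_empty] at hUe
    exact hS U (hUe ▸ inter_subset_right) hne
  have e1 := hS _ inter_subset_right h1
  have e2 := hT _ inter_subset_right h2
  rw [hUe, edgesIn_union hd', card_union_of_disjoint hd']
  push_cast
  linarith

lemma Forest.singleton (v : V) : Forest G {v} := by
  intro T hT hne
  rw [(subset_singleton_iff.1 hT).resolve_left hne.ne_empty]
  simp

lemma Forest.insert {S : Finset V} {v : V} (hS : Forest G S) (hv : v ∉ S)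
    (hd : degIn G S v ≤ 1) : Forest G (insert v S) := by
  rw [insert_eq]
  refine (Forest.singleton v).union hS (disjoint_singleton_left.2 hv) ?_
  rwa [cross_singleton_left]

lemma Sparse.mono {S T : Finset V} (h : Sparse k G c T) (hST : S ⊆ T) : Sparse k G c S :=
  fun A hA => h A (hA.trans hST)

end Counting

/-! ### Replacing a coloured subset by a single edge. -/

section Contraction

variable {V : Type*} [DecidableEq V]

/-- `u` is linked to `a` (to `b`) if it has at least one (at least two) neighbours in `F`. -/
def Link (G : SimpleGraph V) (R F : Finset V) (a b u w : V) : Prop :=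
  u ∈ R ∧ ((w = a ∧ 1 ≤ degIn G F u) ∨ (w = b ∧ 2 ≤ degIn G F u))

/-- The graph on `R ∪ {a, b}` in which the vertices outside `R` are replaced by an edge `ab` that
takes over the edges from `R` to `F`. -/
def contract (G : SimpleGraph V) (R F : Finset V) (a b : V) : SimpleGraph V where
  Adj u w := u ≠ w ∧ ((u ∈ R ∧ w ∈ R ∧ G.Adj u w) ∨ Link G R F a b u w ∨ Link G R F a b w u ∨
    (u = a ∧ w = b) ∨ (u = b ∧ w = a))
  symm := ⟨fun u w h => ⟨h.1.symm, by
    rcases h.2 with h | h | h | h | h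
    · exact Or.inl ⟨h.2.1, h.1, h.2.2.symm⟩
    all_goals tauto⟩⟩
  loopless := ⟨fun _ h => h.1 rfl⟩

variable {G : SimpleGraph V} {R F : Finset V} {a b : V}

lemma contract_adj_of_mem (ha : a ∉ R) (hb : b ∉ R) {u w : V} (hu : u ∈ R) (hw : w ∈ R) :
    (contract G R F a b).Adj u w ↔ G.Adj u w := by
  have hua : u ≠ a := fun h => ha (h ▸ hu)
  have hub : u ≠ b := fun h => hb (h ▸ hu)
  have hwa : w ≠ a := fun h => ha (h ▸ hw)
  have hwb : w ≠ b := fun h => hb (h ▸ hw)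
  simp only [contract, Link, hu, hw, hua, hub, hwa, hwb, true_and, false_and, or_false]
  exact ⟨fun h => h.2, fun h => ⟨h.ne, h⟩⟩

lemma contract_adj_left (ha : a ∉ R) (hb : b ∉ R) (hab : a ≠ b) {u : V} (hu : u ∈ R) :
    (contract G R F a b).Adj u a ↔ 1 ≤ degIn G F u := by
  have hua : u ≠ a := fun h => ha (h ▸ hu)
  have hub : u ≠ b := fun h => hb (h ▸ hu)
  simp [contract, Link, hu, hua, hub, ha, hab]

lemma contract_adj_right (ha : a ∉ R) (hb : b ∉ R) (hab : a ≠ b) {u : V} (hu : u ∈ R) :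
    (contract G R F a b).Adj u b ↔ 2 ≤ degIn G F u := by
  have hua : u ≠ a := fun h => ha (h ▸ hu)
  have hub : u ≠ b := fun h => hb (h ▸ hu)
  simp [contract, Link, hu, hua, hub, hb, hab.symm]

lemma contract_adj_pair (hab : a ≠ b) : (contract G R F a b).Adj a b := by
  simp [contract, hab]

lemma contract_adjI_of_mem (ha : a ∉ R) (hb : b ∉ R) {u w : V} (hu : u ∈ R) (hw : w ∈ R) :
    adjI (contract G R F a b) u w = adjI G u w :=
  adjI_congr (contract_adj_of_mem ha hb hu hw)

lemma contract_degIn (ha : a ∉ R) (hb : b ∉ R) {u : V} {B : Finset V} (hu : u ∈ R)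
    (hB : B ⊆ R) : degIn (contract G R F a b) B u = degIn G B u :=
  sum_congr rfl fun _ hw => contract_adjI_of_mem ha hb hu (hB hw)

lemma contract_edgesIn (ha : a ∉ R) (hb : b ∉ R) {B : Finset V} (hB : B ⊆ R) :
    edgesIn (contract G R F a b) B = edgesIn G B := by
  unfold edgesIn cross
  rw [sum_congr rfl fun u hu => contract_degIn ha hb (hB hu) hB]

lemma contract_pot (ha : a ∉ R) (hb : b ∉ R) {k : ℤ} {c : V → ℤ} {B : Finset V} (hB : B ⊆ R) :
    pot k (contract G R F a b) c B = pot k G c B := by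
  unfold pot
  rw [contract_edgesIn ha hb hB]

lemma contract_degIn_pair (ha : a ∉ R) (hb : b ∉ R) (hab : a ≠ b) {u : V} (hu : u ∈ R) :
    degIn (contract G R F a b) {a, b} u = min 2 (degIn G F u) := by
  rw [degIn_pair hab]
  simp only [adjI, contract_adj_left ha hb hab hu, contract_adj_right ha hb hab hu]
  have := degIn_nonneg (G := G) F u
  split_ifs <;> omega

lemma contract_degIn_le (ha : a ∉ R) (hb : b ∉ R) (hab : a ≠ b) {u : V} {P : Finset V}
    (hu : u ∈ R) (hP : P ⊆ {a, b}) : degIn (contract G R F a b) P u ≤ degIn G F u :=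
  (degIn_mono hP u).trans ((contract_degIn_pair ha hb hab hu).trans_le (min_le_right _ _))

/-- A vertex with two neighbours in F closes a triangle with a and b, so every vertex of F' sends at
most one edge to F. Up to that threshold the contraction counts edges to F exactly, and the forest
bound with a and b added is what F' needs to be attached to F. -/
lemma forest_of_contract (ha : a ∉ R) (hb : b ∉ R) (hab : a ≠ b) (hF : Forest G F)
    (hd : Disjoint F R) {F' : Finset V} (hF' : F' ⊆ R)
    (h : Forest (contract G R F a b) (F' ∪ {a, b})) : Forest G (F ∪ F') := by
  have hpair : edgesIn (contract G R F a b) {a, b} = 1 := by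
    rw [edgesIn_pair hab, adjI_of_adj (contract_adj_pair hab)]
  have hdis : ∀ T ⊆ R, Disjoint T {a, b} := fun T hT => by
    rw [disjoint_insert_right, disjoint_singleton_right]
    exact ⟨fun h => ha (hT h), fun h => hb (hT h)⟩
  -- The forest bound for T ∪ {a, b} is |T| + 1, and the edge ab uses one of these.
  have key : ∀ T ⊆ F', edgesIn G T + ∑ u ∈ T, min 2 (degIn G F u) ≤ T.card := by
    intro T hT
    have h1 := h (T ∪ {a, b}) (union_subset_union hT Subset.rfl) ⟨a, by simp⟩
    rw [edgesIn_union (hdis T (hT.trans hF')), hpair, contract_edgesIn ha hb (hT.trans hF'),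
      card_union_of_disjoint (hdis T (hT.trans hF')), card_pair hab] at h1
    unfold cross at h1
    rw [sum_congr rfl fun u hu => contract_degIn_pair ha hb hab (hF' (hT hu))] at h1
    push_cast at h1
    linarith
  have hle : ∀ u ∈ F', degIn G F u ≤ 1 := by
    intro u hu
    have := key {u} (singleton_subset_iff.2 hu)
    simp at this
    omega
  intro T hT hne
  have hTe : T = (T ∩ F) ∪ (T ∩ F') := by rw [← inter_union_distrib_left, inter_eq_left.2 hT]
  have hdT : Disjoint (T ∩ F) (T ∩ F') :=
    (hd.mono_right hF').mono inter_subset_right inter_subset_right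
  rcases (T ∩ F').eq_empty_or_nonempty with h2 | h2
  · rw [h2, union_empty] at hTe
    exact hF T (hTe ▸ inter_subset_right) hne
  rcases (T ∩ F).eq_empty_or_nonempty with h1 | h1
  · rw [h1, empty_union] at hTe
    have hTF : T ⊆ F' := hTe ▸ inter_subset_right
    have := h T (hTF.trans subset_union_left) hne
    rwa [contract_edgesIn ha hb (hTF.trans hF')] at this
  have e1 := hF _ inter_subset_right h1
  have e2 := key (T ∩ F') inter_subset_right
  have e3 : cross G (T ∩ F) (T ∩ F') ≤ ∑ u ∈ T ∩ F', min 2 (degIn G F u) := by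
    rw [cross_comm]
    refine sum_le_sum fun u hu => ?_
    have h3 := degIn_mono (G := G) (inter_subset_right (s₁ := T) (s₂ := F)) u
    have h4 := hle u (inter_subset_right hu)
    omega
  rw [hTe, edgesIn_union hdT, card_union_of_disjoint hdT]
  push_cast
  linarith

end Contraction

/-! ### Gluing a colouring of a subset to one of the contracted graph. -/

section Merge

variable {V : Type*} [DecidableEq V] {G : SimpleGraph V} {k : ℤ} {c : V → ℤ}

/-- All smaller instances of the sparse colouring problem are solvable. -/
def SmallerColorable (k : ℤ) (S : Finset V) : Prop :=
  ∀ (G : SimpleGraph V) (c : V → ℤ) (T : Finset V), T.card < S.card →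
    (∀ v, 0 ≤ c v ∧ c v ≤ k) → Sparse k G c T → ∃ M F, IsCapColoring G c T M F

/-- Three vertices in A make the contracted instance smaller. `hred` lets edges to M pay for lost
capacity. `hM` leaves vx as the only possible edge between the two M-parts, with a spare place at
both ends, so their union is still a forest within capacity. `hpot` covers the sets that avoid the
new edge; for the others, `hApot` suffices. -/
lemma colorable_of_contract (hk : 3 ≤ k) {S A M F : Finset V} (ih : SmallerColorable k S)
    (hS : Sparse k G c S) (hAS : A ⊆ S) (hA3 : 3 ≤ A.card) (hApot : pot k G c A ≤ 3)
    (hcol : IsCapColoring G c A M F) {c' : V → ℤ} (hc' : ∀ v, 0 ≤ c' v ∧ c' v ≤ k)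
    (hle : ∀ u ∈ S \ A, c' u ≤ c u)
    (hred : ∀ u ∈ S \ A, c u ≤ c' u + k * degIn G M u)
    {x v : V}
    (hM : ∀ u ∈ S \ A, 0 < c' u → ∀ w ∈ M, G.Adj u w →
      u = v ∧ w = x ∧ c' v + 1 ≤ c v ∧ degIn G M x + 2 ≤ c x)
    (hpot : ∀ B ⊆ S \ A, -2 ≤ pot k G c' B) :
    ∃ M F, IsCapColoring G c S M F := by
  set R := S \ A with hR
  obtain ⟨a, haA, b, hbA, hab⟩ := one_lt_card.1 (by omega : 1 < A.card)
  have hdRA : Disjoint R A := sdiff_disjoint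
  have ha : a ∉ R := fun h => disjoint_left.1 hdRA h haA
  have hb : b ∉ R := fun h => disjoint_left.1 hdRA h hbA
  have hMA : M ⊆ A := hcol.union ▸ subset_union_left
  have hFA : F ⊆ A := hcol.union ▸ subset_union_right
  have hdR : Disjoint R ({a, b} : Finset V) := by
    rw [disjoint_insert_right, disjoint_singleton_right]
    exact ⟨ha, hb⟩
  -- Capacity 0 forces a and b into the F-part, as `forest_of_contract` requires.
  let c₁ : V → ℤ := fun u => if u ∈ R then c' u else 0
  have hc₁R : ∀ u ∈ R, c₁ u = c' u := fun u hu => if_pos hu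
  have hc₁0 : ∀ u, u ∉ R → c₁ u = 0 := fun u hu => if_neg hu
  have hpot₁ : ∀ B ⊆ R, pot k (contract G R F a b) c₁ B = pot k G c' B := by
    intro B hB
    rw [contract_pot ha hb hB]
    unfold pot
    rw [sum_congr rfl fun u hu => by rw [hc₁R u (hB hu)]]
  have hsparse : Sparse k (contract G R F a b) c₁ (R ∪ {a, b}) := by
    intro B hB
    have hBe : B = (B ∩ R) ∪ (B ∩ {a, b}) := by
      rw [← inter_union_distrib_left, inter_eq_left.2 hB]
    set B₁ := B ∩ R with hB₁
    set P := B ∩ {a, b} with hP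
    have hB₁R : B₁ ⊆ R := inter_subset_right
    have hPab : P ⊆ {a, b} := inter_subset_right
    rcases P.eq_empty_or_nonempty with hPe | hPne
    · rw [hBe, hPe, union_empty, hpot₁ B₁ hB₁R]
      exact hpot B₁ hB₁R
    have hPpot : 3 * k - 2 ≤ pot k (contract G R F a b) c₁ P := by
      have hca := hc₁0 a ha
      have hcb := hc₁0 b hb
      have hPab' : P = {a} ∨ P = {b} ∨ P = {a, b} := by
        by_cases h1 : a ∈ P <;> by_cases h2 : b ∈ P
        · right; right
          exact Subset.antisymm hPab (by simp [insert_subset_iff, h1, h2])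
        · left
          refine Subset.antisymm (fun z hz => ?_) (by simpa using h1)
          rcases mem_insert.1 (hPab hz) with rfl | h
          · simp
          · rw [mem_singleton] at h
            exact absurd (h ▸ hz) h2
        · right; left
          refine Subset.antisymm (fun z hz => ?_) (by simpa using h2)
          rcases mem_insert.1 (hPab hz) with rfl | h
          · exact absurd hz h1
          · exact h
        · obtain ⟨z, hz⟩ := hPne
          rcases mem_insert.1 (hPab hz) with rfl | h
          · exact absurd hz h1
          · rw [mem_singleton] at h
            exact absurd (h ▸ hz) h2
      rcases hPab' with h | h | h
      · rw [h, pot_singleton, hca]; linarith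
      · rw [h, pot_singleton, hcb]; linarith
      · rw [h, pot_pair hab, hca, hcb, adjI_of_adj (contract_adj_pair hab)]; linarith
    have hdB : Disjoint B₁ P := hdR.mono hB₁R hPab
    have hdA : Disjoint A B₁ := hdRA.symm.mono_right hB₁R
    have h1 := hS (A ∪ B₁) (union_subset hAS (hB₁R.trans sdiff_subset))
    rw [pot_union hdA, cross_comm] at h1
    have h2 := pot_change_cap (k := k) (G := G) (c := c) c' B₁
    rw [hBe, pot_union hdB, hpot₁ B₁ hB₁R, h2]
    -- Edges to F bound the new edges and edges to M pay for the capacity loss, so exchanging A for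
    -- P loses at most the potential of A, and P brings back at least 3k - 2.
    have h3 : ∑ u ∈ B₁, (c u - c' u) + k * cross (contract G R F a b) B₁ P
        ≤ k * cross G B₁ A := by
      unfold cross
      rw [mul_sum, mul_sum, ← sum_add_distrib]
      refine sum_le_sum fun u hu => ?_
      have h4 := hred u (hB₁R hu)
      have h5 := contract_degIn_le (G := G) (F := F) ha hb hab (hB₁R hu) hPab
      rw [← hcol.union, degIn_union hcol.disj]
      nlinarith
    linarith
  have hcard : (R ∪ {a, b}).card < S.card := by
    rw [card_union_of_disjoint hdR, card_pair hab]
    have : R.card + A.card = S.card := card_sdiff_add_card_eq_card hAS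
    omega
  obtain ⟨M₁, F₁, h₁⟩ := ih _ c₁ _ hcard (fun u => by
    by_cases hu : u ∈ R
    · rw [hc₁R u hu]; exact hc' u
    · rw [hc₁0 u hu]; exact ⟨le_rfl, by linarith⟩) hsparse
  have hM₁R : M₁ ⊆ R := by
    intro u hu
    by_contra hn
    have := h₁.deg u hu
    rw [hc₁0 u hn] at this
    linarith [degIn_nonneg (G := contract G R F a b) M₁ u]
  have hdeg₁ : ∀ u ∈ M₁, degIn G M₁ u + 1 ≤ c' u := by
    intro u hu
    have := h₁.deg u hu
    rwa [hc₁R u (hM₁R hu), contract_degIn ha hb (hM₁R hu) hM₁R] at this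
  have hpos : ∀ u ∈ M₁, 0 < c' u := fun u hu => by
    linarith [hdeg₁ u hu, degIn_nonneg (G := G) M₁ u]
  have habF : ∀ z ∈ ({a, b} : Finset V), z ∈ F₁ := by
    intro z hz
    have hz' : z ∈ M₁ ∪ F₁ := h₁.union ▸ mem_union_right _ hz
    exact (mem_union.1 hz').resolve_left fun h => disjoint_left.1 hdR (hM₁R h) hz
  have hF₁e : F₁ = (F₁ ∩ R) ∪ {a, b} := by
    ext z
    have : z ∈ F₁ → z ∈ R ∪ {a, b} := fun h => h₁.union ▸ mem_union_right _ h
    rw [mem_union, mem_inter]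
    constructor
    · intro h
      exact (mem_union.1 (this h)).imp (fun h' => ⟨h, h'⟩) id
    · rintro (h | h)
      · exact h.1
      · exact habF z h
  have hforF : Forest G (F ∪ (F₁ ∩ R)) :=
    forest_of_contract ha hb hab hcol.forestF (hdRA.symm.mono_left hFA) inter_subset_right
      (hF₁e ▸ h₁.forestF)
  have hforM₁ : Forest G M₁ := fun T hT hne => by
    have := h₁.forestM T hT hne
    rwa [contract_edgesIn ha hb (hT.trans hM₁R)] at this
  have hdM : Disjoint M M₁ := hdRA.symm.mono hMA hM₁R
  have hM1 : ∀ u ∈ M₁, degIn G M u ≤ 1 := fun u hu =>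
    degIn_le_one fun w hw h => (hM u (hM₁R hu) (hpos u hu) w hw h).2.1
  have hM2 : ∀ w ∈ M, degIn G M₁ w ≤ 1 := fun w hw =>
    degIn_le_one fun u hu h => (hM u (hM₁R hu) (hpos u hu) w hw h.symm).1
  have hcross : cross G M M₁ ≤ 1 := by
    by_cases hx : x ∈ M
    · unfold cross
      rw [sum_eq_single_of_mem x hx]
      · exact hM2 x hx
      · intro w hw hwx
        exact degIn_eq_zero fun u hu h =>
          hwx (hM u (hM₁R hu) (hpos u hu) w hw h.symm).2.1
    · unfold cross
      rw [sum_eq_zero]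
      · norm_num
      · intro w hw
        exact degIn_eq_zero fun u hu h =>
          hx ((hM u (hM₁R hu) (hpos u hu) w hw h.symm).2.1 ▸ hw)
  refine ⟨M ∪ M₁, F ∪ (F₁ ∩ R), ?_, ?_, hcol.forestM.union hforM₁ hdM hcross, hforF, ?_⟩
  · rw [disjoint_union_left, disjoint_union_right, disjoint_union_right]
    exact ⟨⟨hcol.disj, hdRA.symm.mono hMA inter_subset_right⟩,
      hdRA.mono hM₁R hFA, h₁.disj.mono_right inter_subset_left⟩
  · have hR' : M₁ ∪ (F₁ ∩ R) = R := by
      ext z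
      have : z ∈ R → z ∈ M₁ ∪ F₁ := fun h => h₁.union ▸ mem_union_left _ h
      have h2 : z ∈ M₁ → z ∈ R := fun h => hM₁R h
      simp only [mem_union, mem_inter] at this ⊢
      tauto
    rw [union_union_union_comm, hcol.union, hR', hR, union_sdiff_of_subset hAS]
  · intro u hu
    rw [degIn_union hdM]
    rcases mem_union.1 hu with hu | hu
    · by_cases h0 : degIn G M₁ u = 0
      · rw [h0, add_zero]; exact hcol.deg u hu
      · obtain ⟨w, hw, hadj⟩ := exists_adj_of_degIn_ne_zero h0
        obtain ⟨_, rfl, _, h3⟩ := hM w (hM₁R hw) (hpos w hw) u hu hadj.symm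
        linarith [hM2 u hu]
    · by_cases h0 : degIn G M u = 0
      · rw [h0, zero_add]
        exact (hdeg₁ u hu).trans (hle u (hM₁R hu))
      · obtain ⟨w, hw, hadj⟩ := exists_adj_of_degIn_ne_zero h0
        obtain ⟨rfl, _, h3, _⟩ := hM u (hM₁R hu) (hpos u hu) w hw hadj
        linarith [hM1 u hu, hdeg₁ u hu]

end Merge

/-! ### Lower bounds on the potential of proper subsets. -/

section Gap

variable {V : Type*} [DecidableEq V] {G : SimpleGraph V} {k : ℤ} {c : V → ℤ}

/-- One vertex has potential at least 3k - 1 and two have at least 3k - 2, both above 3. -/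
lemma three_le_card_of_pot_le (hk : 3 ≤ k) (hc : ∀ v, 0 ≤ c v) {A : Finset V}
    (hne : A.Nonempty) (h : pot k G c A ≤ 3) : 3 ≤ A.card := by
  by_contra hlt
  have hpos := hne.card_pos
  have hcases : A.card = 1 ∨ A.card = 2 := by omega
  rcases hcases with h1 | h2
  · obtain ⟨v, rfl⟩ := card_eq_one.1 h1
    rw [pot_singleton] at h
    linarith [hc v]
  · obtain ⟨a, b, hab, rfl⟩ := card_eq_two.1 h2
    rw [pot_pair hab] at h
    nlinarith [hc a, hc b, adjI_le_one (G := G) a b]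

lemma IsCapColoring.mono_cap {c' : V → ℤ} {S M F : Finset V} (h : IsCapColoring G c' S M F)
    (hc : ∀ v, c' v ≤ c v) : IsCapColoring G c S M F :=
  ⟨h.disj, h.union, h.forestM, h.forestF, fun v hv => (h.deg v hv).trans (hc v)⟩

/-- The potential of `A ∪ B`, when the capacities on `B` are compared with `c'`. -/
lemma pot_union_cap {A B : Finset V} (hd : Disjoint A B) (c' : V → ℤ) :
    pot k G c' B = pot k G c (A ∪ B) - pot k G c A
      + 3 * ∑ u ∈ B, (k * degIn G A u - (c u - c' u)) := by
  rw [pot_union hd, pot_change_cap (c := c) c' B, cross_comm, sum_sub_distrib (fun u => k * degIn G A u), ← mul_sum]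
  unfold cross
  ring

lemma degIn_eq_add_of_coloring {A M F : Finset V} {c : V → ℤ} (h : IsCapColoring G c A M F)
    (u : V) : degIn G A u = degIn G M u + degIn G F u := by
  rw [← h.union, degIn_union h.disj]

/-- Proper nonempty subsets of an uncolourable sparse graph, all whose smaller instances are
colourable, have positive potential. -/
lemma one_le_pot_of_not_colorable (hk : 3 ≤ k) (hc : ∀ v, 0 ≤ c v ∧ c v ≤ k) {S : Finset V}
    (ih : SmallerColorable k S) (hS : Sparse k G c S)
    (hno : ¬ ∃ M F, IsCapColoring G c S M F) {A : Finset V} (hAS : A ⊂ S)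
    (hne : A.Nonempty) : 1 ≤ pot k G c A := by
  by_contra hlt
  have hA3 := three_le_card_of_pot_le hk (fun v => (hc v).1) hne (by omega : pot k G c A ≤ 3)
  obtain ⟨M, F, hcol⟩ := ih G c A (card_lt_card hAS) hc (hS.mono hAS.1)
  obtain ⟨x, -⟩ := hne
  -- Every outside neighbour of M is forced into F, so no edge joins the two M-parts.
  let c' : V → ℤ := fun u => if degIn G M u = 0 then c u else 0
  have hred : ∀ u, c u ≤ c' u + k * degIn G M u := by
    intro u
    have h0 := degIn_nonneg (G := G) M u
    by_cases h : degIn G M u = 0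
    · simp only [c', h, if_true]; linarith
    · simp only [c', h, if_false]
      have : 1 ≤ degIn G M u := by omega
      nlinarith [(hc u).2]
  refine hno (colorable_of_contract (c' := c') (x := x) (v := x) hk ih hS hAS.1 hA3 (by omega) hcol
    ?_ ?_ (fun u _ => hred u) ?_ ?_)
  · intro v
    by_cases h : degIn G M v = 0
    · simp only [c', h, if_true]; exact hc v
    · simp only [c', h, if_false]; omega
  · intro u _
    by_cases h : degIn G M u = 0
    · simp only [c', h, if_true]; exact le_rfl
    · simp only [c', h, if_false]; exact (hc u).1
  · intro u _ hpos w hw hadj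
    have := one_le_degIn hw hadj
    simp only [c'] at hpos
    rw [if_neg (by omega)] at hpos
    exact absurd hpos (lt_irrefl 0)
  · intro B hB
    have hd : Disjoint A B := (sdiff_disjoint.mono_left hB).symm
    rw [pot_union_cap (c := c) hd]
    have h1 := hS (A ∪ B) (union_subset hAS.1 (hB.trans sdiff_subset))
    have h2 : 0 ≤ ∑ u ∈ B, (k * degIn G A u - (c u - c' u)) := by
      refine sum_nonneg fun u _ => ?_
      rw [degIn_eq_add_of_coloring hcol]
      nlinarith [hred u, degIn_nonneg (G := G) F u]
    linarith

/-- Lowering one capacity by one keeps proper subsets of an uncolourable sparse graph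
colourable; hence they have potential at least `4`. -/
lemma four_le_pot_of_not_colorable (hk : 3 ≤ k) (hc : ∀ v, 0 ≤ c v ∧ c v ≤ k) {S : Finset V}
    (ih : SmallerColorable k S) (hS : Sparse k G c S)
    (hno : ¬ ∃ M F, IsCapColoring G c S M F) {A : Finset V} (hAS : A ⊂ S)
    (hne : A.Nonempty) : 4 ≤ pot k G c A := by
  have gap := fun {B : Finset V} => one_le_pot_of_not_colorable hk hc ih hS hno (A := B)
  by_contra hlt
  have hA3 := three_le_card_of_pot_le hk (fun v => (hc v).1) hne (by omega : pot k G c A ≤ 3)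
  have hRne : (S \ A).Nonempty := sdiff_nonempty.2 hAS.2
  have hRS : S \ A ⊂ S := by
    refine ⟨sdiff_subset, fun h => ?_⟩
    obtain ⟨z, hz⟩ := hne
    exact (mem_sdiff.1 (h (hAS.1 hz))).2 hz
  -- Without an edge leaving A, colourings of A and S \ A could simply be united.
  obtain ⟨x, hxA, v, hvR, hxv⟩ : ∃ x ∈ A, ∃ v ∈ S \ A, G.Adj v x := by
    by_contra! hcon
    have h0 : cross G A (S \ A) = 0 :=
      sum_eq_zero fun x hx => degIn_eq_zero fun v hv h => hcon x hx v hv h.symm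
    have h1 := pot_union (k := k) (G := G) (c := c) (disjoint_sdiff (s := A) (t := S))
    rw [h0, union_sdiff_of_subset hAS.1] at h1
    have h2 := gap hAS hne
    have h3 := gap hRS hRne
    obtain ⟨M, F, hMF⟩ := ih G c A (card_lt_card hAS) hc (hS.mono hAS.1)
    obtain ⟨M', F', hMF'⟩ := ih G c (S \ A) (card_lt_card hRS) hc (hS.mono hRS.1)
    have hMA : M ⊆ A := hMF.union ▸ subset_union_left
    have hFA : F ⊆ A := hMF.union ▸ subset_union_right
    have hMA' : M' ⊆ S \ A := hMF'.union ▸ subset_union_left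
    have hFA' : F' ⊆ S \ A := hMF'.union ▸ subset_union_right
    have hd : Disjoint A (S \ A) := disjoint_sdiff
    have hz : ∀ X ⊆ A, ∀ Y ⊆ S \ A, cross G X Y ≤ 1 := fun X hX Y hY =>
      (cross_mono hX hY).trans (by rw [h0]; norm_num)
    refine hno ⟨M ∪ M', F ∪ F', ?_, ?_, hMF.forestM.union hMF'.forestM (hd.mono hMA hMA')
      (hz _ hMA _ hMA'), hMF.forestF.union hMF'.forestF (hd.mono hFA hFA')
      (hz _ hFA _ hFA'), ?_⟩
    · rw [disjoint_union_left, disjoint_union_right, disjoint_union_right]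
      exact ⟨⟨hMF.disj, hd.mono hMA hFA'⟩, (hd.mono hFA hMA').symm, hMF'.disj⟩
    · rw [union_union_union_comm, hMF.union, hMF'.union, union_sdiff_of_subset hAS.1]
    · intro u hu
      rw [degIn_union (hd.mono hMA hMA')]
      rcases mem_union.1 hu with hu | hu
      · rw [degIn_eq_zero (S := M') fun w hw h => hcon u (hMA hu) w (hMA' hw) h.symm, add_zero]
        exact hMF.deg u hu
      · rw [degIn_eq_zero (S := M) fun w hw h => hcon w (hMA hw) u (hMA' hu) h, zero_add]
        exact hMF'.deg u hu
  -- Potential at least 1 survives the cost 3 of one unit. If x lands in M, that unit is a spare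
  -- place for v.
  let cx : V → ℤ := fun u => if u = x then max (c u - 1) 0 else c u
  have hcx_le : ∀ u, cx u ≤ c u := fun u => by
    have := (hc u).1
    simp only [cx]; split_ifs <;> omega
  have hcx_ge : ∀ u, c u - (if u = x then 1 else 0) ≤ cx u := fun u => by
    simp only [cx]; split_ifs <;> omega
  have hcx_nonneg : ∀ u, 0 ≤ cx u := fun u => by
    have := (hc u).1
    simp only [cx]; split_ifs <;> omega
  have hsp : Sparse k G cx A := by
    intro B hB
    rcases B.eq_empty_or_nonempty with rfl | hBne
    · simp
    have h1 := gap (Finset.ssubset_of_subset_of_ssubset hB hAS) hBne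
    rw [pot_change_cap (c := c) cx B]
    have h2 : ∑ u ∈ B, (c u - cx u) ≤ ∑ u ∈ B, (if u = x then 1 else 0) :=
      sum_le_sum fun u _ => by linarith [hcx_ge u]
    have h3 : ∑ u ∈ B, (if u = x then (1 : ℤ) else 0) ≤ 1 := by
      rw [sum_ite_eq']; split_ifs <;> norm_num
    linarith
  obtain ⟨M, F, hcolx⟩ := ih G cx A (card_lt_card hAS)
    (fun u => ⟨hcx_nonneg u, (hcx_le u).trans (hc u).2⟩) hsp
  have hcol := hcolx.mono_cap hcx_le
  have hxM : x ∈ M → degIn G M x + 2 ≤ c x := by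
    intro hx
    have h1 := hcolx.deg x hx
    have h2 := degIn_nonneg (G := G) M x
    simp only [cx, if_true] at h1
    omega
  -- Under this condition v may enter M at the cost of only one unit, since vx is then its only
  -- possible edge to M.
  let P : V → Prop := fun u => u = v ∧ ∀ w ∈ M, G.Adj u w → w = x
  classical
  let c' : V → ℤ := fun u => if degIn G M u = 0 then c u else if P u then max (c u - 1) 0 else 0
  have hc'0 : ∀ u, 0 ≤ c' u := by
    intro u
    have := (hc u).1
    simp only [c']; split_ifs <;> omega
  have hc'le : ∀ u, c' u ≤ c u := by
    intro u
    have := (hc u).1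
    simp only [c']; split_ifs <;> omega
  have hred : ∀ u, c u ≤ c' u + k * degIn G M u := by
    intro u
    have h0 := degIn_nonneg (G := G) M u
    by_cases h : degIn G M u = 0
    · simp only [c', h, if_true]; linarith
    · have : 1 ≤ degIn G M u := by omega
      nlinarith [(hc u).2, hc'0 u]
  have hslack : ∀ u, 0 ≤ k * degIn G A u - (c u - c' u) := by
    intro u
    rw [degIn_eq_add_of_coloring hcol]
    nlinarith [hred u, degIn_nonneg (G := G) F u]
  -- An edge to A is worth k. If v loses all its capacity, it has a second neighbour in A besides x;
  -- otherwise it loses at most one unit.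
  have hslackv : 1 ≤ k * degIn G A v - (c v - c' v) := by
    have hA1 := one_le_degIn hxA hxv
    have hAv := degIn_eq_add_of_coloring hcol v
    have hM0 := degIn_nonneg (G := G) M v
    have hF0 := degIn_nonneg (G := G) F v
    by_cases h : degIn G M v = 0
    · simp only [c', h, if_true]
      nlinarith
    by_cases hP : P v
    · simp only [c', h, if_false, hP, if_true]
      have : c v - max (c v - 1) 0 ≤ 1 := by omega
      nlinarith
    · simp only [c', h, if_false, hP]
      have h2 : 2 ≤ degIn G A v := by
        obtain ⟨w, hw, hvw, hwx⟩ : ∃ w ∈ M, G.Adj v w ∧ w ≠ x := by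
          simpa [P] using hP
        have hwA : w ∈ A := hcol.union ▸ mem_union_left _ hw
        have := degIn_mono (G := G) (S := {w, x}) (T := A)
          (by simp [insert_subset_iff, hwA, hxA]) v
        rwa [degIn_pair hwx, adjI_of_adj hvw, adjI_of_adj hxv] at this
      nlinarith [(hc v).2]
  refine hno (colorable_of_contract (c' := c') (x := x) (v := v) hk ih hS hAS.1 hA3 (by omega) hcol
    (fun u => ⟨hc'0 u, (hc'le u).trans (hc u).2⟩) (fun u _ => hc'le u) (fun u _ => hred u) ?_ ?_)
  · intro u _ hpos w hw hadj
    have h1 := one_le_degIn hw hadj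
    have h0 : degIn G M u ≠ 0 := by omega
    by_cases hP : P u
    · have hwx := hP.2 w hw hadj
      obtain rfl := hP.1
      refine ⟨rfl, hwx, ?_, hxM (hwx ▸ hw)⟩
      simp only [c', h0, if_false, hP, if_true] at hpos ⊢
      omega
    · simp only [c', h0, if_false, hP, lt_irrefl] at hpos
  · intro B hB
    rcases B.eq_empty_or_nonempty with rfl | hBne
    · simp
    have hd : Disjoint A B := (sdiff_disjoint.mono_left hB).symm
    rw [pot_union_cap (c := c) hd]
    have hAB := union_subset hAS.1 (hB.trans sdiff_subset)
    have h1 := hS (A ∪ B) hAB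
    -- Removing A may cost 3. If v is in B, its slack repays 3; if not, A ∪ B is proper and starts
    -- from potential 1 instead of -2.
    by_cases hvB : v ∈ B
    · have h2 : 1 ≤ ∑ u ∈ B, (k * degIn G A u - (c u - c' u)) :=
        hslackv.trans (single_le_sum (f := fun u => k * degIn G A u - (c u - c' u))
          (fun u _ => hslack u) hvB)
      linarith
    · have h2 : 0 ≤ ∑ u ∈ B, (k * degIn G A u - (c u - c' u)) := sum_nonneg fun u _ => hslack u
      have h3 : A ∪ B ⊂ S := by
        refine ⟨hAB, fun h => ?_⟩
        have hv := mem_sdiff.1 hvR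
        exact (mem_union.1 (h hv.1)).elim hv.2 hvB
      have h4 := gap h3 (hne.mono subset_union_left)
      linarith

end Gap

/-! ### Degree bounds and discharging. -/

section Main

variable {V : Type*} [DecidableEq V] {G : SimpleGraph V} {k : ℤ} {c : V → ℤ}

lemma IsCapColoring.insert_F {S M F : Finset V} {v : V} (h : IsCapColoring G c (S.erase v) M F)
    (hv : v ∈ S) (hF : degIn G F v ≤ 1) : IsCapColoring G c S M (insert v F) := by
  have hvn : v ∉ M ∪ F := h.union ▸ notMem_erase v S
  rw [mem_union, not_or] at hvn
  refine ⟨disjoint_insert_right.2 ⟨hvn.1, h.disj⟩, ?_, h.forestM, h.forestF.insert hvn.2 hF,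
    h.deg⟩
  rw [union_insert, h.union, insert_erase hv]

lemma IsCapColoring.insert_M {c' : V → ℤ} {S M F : Finset V} {v : V}
    (h : IsCapColoring G c' (S.erase v) M F) (hv : v ∈ S) (hM : degIn G M v ≤ 1)
    (hle : ∀ u, c' u ≤ c u) (hcv : degIn G M v + 1 ≤ c v)
    (hnbr : ∀ u ∈ M, G.Adj u v → c' u + 1 ≤ c u) : IsCapColoring G c S (insert v M) F := by
  have hvn : v ∉ M ∪ F := h.union ▸ notMem_erase v S
  rw [mem_union, not_or] at hvn
  have hins : ∀ u, degIn G (insert v M) u = adjI G u v + degIn G M u := fun u => by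
    rw [insert_eq, degIn_union (disjoint_singleton_left.2 hvn.1), degIn_singleton]
  refine ⟨disjoint_insert_left.2 ⟨hvn.2, h.disj⟩, ?_, h.forestM.insert hvn.1 hM, h.forestF, ?_⟩
  · rw [insert_union, h.union, insert_erase hv]
  · intro u hu
    rw [hins]
    rcases mem_insert.1 hu with rfl | hu
    · rw [adjI_self, zero_add]; exact hcv
    · have h1 := h.deg u hu
      by_cases hadj : G.Adj u v
      · rw [adjI_of_adj hadj]
        linarith [hnbr u hu hadj]
      · rw [adjI_of_not_adj hadj]
        linarith [hle u]

lemma degIn_erase_self (S : Finset V) (v : V) : degIn G (S.erase v) v = degIn G S v := by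
  unfold degIn
  exact sum_erase _ (adjI_self v)

lemma degIn_eq_of_coloring {c' : V → ℤ} {S M F : Finset V} {v : V}
    (h : IsCapColoring G c' (S.erase v) M F) : degIn G M v + degIn G F v = degIn G S v := by
  rw [← degIn_erase_self S v, ← h.union, degIn_union h.disj]

/-- A vertex of an uncolourable sparse graph, all whose smaller instances are colourable, has
nonpositive charge. -/
lemma charge_le_of_not_colorable (hk : 3 ≤ k) (hc : ∀ v, 0 ≤ c v ∧ c v ≤ k) {S : Finset V}
    (ih : SmallerColorable k S) (hS : Sparse k G c S)
    (hno : ¬ ∃ M F, IsCapColoring G c S M F) {v : V} (hv : v ∈ S) :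
    2 ≤ degIn G S v ∧ 6 * k - 2 + 6 * c v - 3 * k * degIn G S v ≤ -2 := by
  have hlt : (S.erase v).card < S.card := card_erase_lt_of_mem hv
  obtain ⟨M, F, hcol⟩ := ih G c _ hlt hc (hS.mono (erase_subset v S))
  have hsum := degIn_eq_of_coloring hcol
  have hM0 := degIn_nonneg (G := G) M v
  have hF2 : 2 ≤ degIn G F v := by
    by_contra hF
    exact hno ⟨_, _, hcol.insert_F hv (by omega)⟩
  refine ⟨by omega, ?_⟩
  have hcv := hc v
  have h3 : 1 ≤ c v → 3 ≤ degIn G S v := by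
    intro h1
    by_contra h
    have hM : degIn G M v = 0 := by omega
    refine hno ⟨_, _, hcol.insert_M hv (by omega) (fun _ => le_rfl) (by omega) ?_⟩
    intro u hu hadj
    have := one_le_degIn hu hadj.symm
    omega
  have h4 : 2 ≤ c v → 4 ≤ degIn G S v := by
    intro h2
    by_contra h
    have hdeg : degIn G S v = 3 := by have := h3 (by omega); omega
    -- Each neighbour of v keeps one place free, so that v can join M afterwards.
    let c' : V → ℤ := fun u => max (c u - adjI G v u) 0
    have hc'le : ∀ u, c' u ≤ c u := fun u => by
      have := adjI_nonneg (G := G) v u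
      have := (hc u).1
      simp only [c']; omega
    have hsp : Sparse k G c' (S.erase v) := by
      intro B hB
      rcases B.eq_empty_or_nonempty with rfl | hBne
      · simp
      have hvB : v ∉ B := fun h => notMem_erase v S (hB h)
      have hBS : B ⊂ S := Finset.ssubset_of_subset_of_ssubset hB (erase_ssubset hv)
      have hgap := four_le_pot_of_not_colorable hk hc ih hS hno hBS hBne
      rw [pot_change_cap (c := c) c' B]
      have h5 : ∑ u ∈ B, (c u - c' u) ≤ degIn G B v := sum_le_sum fun u _ => by
        simp only [c']; omega
      have h6 := degIn_mono (G := G) hBS.1 v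
      -- Two reserved places cost 6, which potential 4 can afford. With all three neighbours in B,
      -- sparsity of B ∪ {v} gives B potential at least 3k - 1; the cost 9 is affordable because k ≥
      -- 3.
      by_cases h7 : degIn G B v ≤ 2
      · linarith
      · have h8 := hS (insert v B) (insert_subset hv hBS.1)
        rw [pot_insert hvB, show degIn G B v = 3 by omega] at h8
        linarith
    obtain ⟨M, F, hcol⟩ := ih G c' _ hlt
      (fun u => ⟨le_max_right _ _, (hc'le u).trans (hc u).2⟩) hsp
    have hsum := degIn_eq_of_coloring hcol
    by_cases hF : degIn G F v ≤ 1
    · exact hno ⟨_, _, (hcol.insert_F hv hF).mono_cap hc'le⟩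
    · refine hno ⟨_, _, hcol.insert_M hv (by omega) hc'le (by omega) ?_⟩
      intro u hu hadj
      have h5 := hcol.deg u hu
      have h6 := degIn_nonneg (G := G) M u
      simp only [c', adjI_of_adj hadj.symm] at h5 ⊢
      omega
  -- The bound -2 is attained at capacity 0 with degree 2 and at capacity k with degree 4.
  by_cases h2 : 2 ≤ c v
  · nlinarith [h4 h2]
  by_cases h1 : 1 ≤ c v
  · nlinarith [h3 h1]
  · nlinarith

theorem colorable_of_sparse (hk : 3 ≤ k) (n : ℕ) : ∀ (G : SimpleGraph V) (c : V → ℤ)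
    (S : Finset V), S.card = n → (∀ v, 0 ≤ c v ∧ c v ≤ k) → Sparse k G c S →
    ∃ M F, IsCapColoring G c S M F := by
  induction n using Nat.strong_induction_on with
  | _ n ih =>
    intro G c S hn hc hS
    have ih' : SmallerColorable k S := fun G' c' T hT => ih T.card (hn ▸ hT) G' c' T rfl
    by_contra hno
    have hcharge := fun v (hv : v ∈ S) => charge_le_of_not_colorable hk hc ih' hS hno hv
    have h1 := two_mul_pot (k := k) (G := G) (c := c) S
    have h2 : ∑ v ∈ S, (6 * k - 2 + 6 * c v - 3 * k * degIn G S v) ≤ ∑ _v ∈ S, (-2 : ℤ) :=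
      sum_le_sum fun v hv => (hcharge v hv).2
    rw [← h1, sum_const, nsmul_eq_mul] at h2
    have h3 := hS S Subset.rfl
    rcases S.eq_empty_or_nonempty with rfl | ⟨v, hv⟩
    · exact hno ⟨∅, ∅, disjoint_empty_left _, empty_union _, Forest.empty, Forest.empty, by simp⟩
    have h4 := (hcharge v hv).1
    rw [← degIn_erase_self] at h4
    have h5 : degIn G (S.erase v) v ≤ (S.erase v).card := by
      have := sum_le_card_nsmul (S.erase v) (fun u => adjI G v u) 1 fun u _ => adjI_le_one v u
      simpa [degIn] using this
    have h6 := card_erase_add_one hv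
    have h7 : (3 : ℤ) ≤ S.card := by omega
    linarith

end Main

/-! ### From integer counts to induced graphs and real bounds. -/

section Bridge

variable {V : Type*} [DecidableEq V] {G : SimpleGraph V}

lemma degIn_eq_card_filter (S : Finset V) (v : V) [DecidablePred (G.Adj v)] :
    degIn G S v = (S.filter (G.Adj v)).card := by
  rw [card_filter]
  push_cast
  refine sum_congr rfl fun u _ => ?_
  split_ifs with h
  · exact adjI_of_adj h
  · exact adjI_of_not_adj h

lemma encard_neighborSet_induce (S : Finset V) (v : (S : Set V)) :
    (((G.induce (S : Set V)).neighborSet v).encard : ℕ∞) = (degIn G S v).toNat := by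
  classical
  rw [degIn_eq_card_filter, Int.toNat_natCast,
    ← Function.Injective.encard_image Subtype.val_injective, ← Set.encard_coe_eq_coe_finsetCard]
  congr 1
  ext w
  simp only [Set.mem_image, SimpleGraph.mem_neighborSet, SimpleGraph.comap_adj,
    Function.Embedding.subtype_apply, Subtype.exists, coe_filter, Set.mem_ofPred_eq]
  constructor
  · rintro ⟨a, ha, h, rfl⟩
    exact ⟨ha, h⟩
  · rintro ⟨ha, h⟩
    exact ⟨w, ha, h, rfl⟩

lemma edgesIn_eq_ncard (S : Finset V) :
    edgesIn G S = ((G.induce (S : Set V)).edgeSet.ncard : ℤ) := by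
  classical
  have h1 := (G.induce (S : Set V)).sum_degrees_eq_twice_card_edges
  have h2 := two_mul_edgesIn (G := G) S
  have h3 : cross G S S = ((∑ v, (G.induce (S : Set V)).degree v : ℕ) : ℤ) := by
    unfold cross
    rw [← sum_coe_sort S, Nat.cast_sum]
    refine sum_congr rfl fun v _ => ?_
    have h4 := encard_neighborSet_induce (G := G) S v
    rw [← SimpleGraph.card_neighborFinset_eq_degree]
    rw [← SimpleGraph.coe_neighborFinset, Set.encard_coe_eq_coe_finsetCard] at h4
    have h5 : ((G.induce (S : Set V)).neighborFinset v).card = (degIn G S v).toNat := by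
      exact_mod_cast h4
    rw [h5, Int.toNat_of_nonneg (degIn_nonneg _ _)]
  rw [← SimpleGraph.coe_edgeFinset, Set.ncard_coe_finset]
  rw [h3, h1] at h2
  push_cast at h2
  linarith

/-- On the support of a cycle every vertex has two neighbours, so there are at least as many edges
as vertices. -/
lemma Forest.isAcyclic {S : Finset V} (h : Forest G S) : (G.induce (S : Set V)).IsAcyclic := by
  intro v p hp
  have hinj : Function.Injective (SimpleGraph.Embedding.induce (G := G) (S : Set V)).toHom :=
    (SimpleGraph.Embedding.induce (G := G) (S : Set V)).injective
  have hq := hp.map hinj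
  set q := p.map (SimpleGraph.Embedding.induce (G := G) (S : Set V)).toHom with hqdef
  have hsub : q.support.toFinset ⊆ S := by
    intro w hw
    rw [List.mem_toFinset, hqdef, SimpleGraph.Walk.support_map, List.mem_map] at hw
    obtain ⟨z, -, rfl⟩ := hw
    exact z.2
  have h1 := h _ hsub ⟨_, List.mem_toFinset.2 q.start_mem_support⟩
  have h2 := two_mul_edgesIn (G := G) q.support.toFinset
  have h3 : ∑ _u ∈ q.support.toFinset, (2 : ℤ) ≤ cross G q.support.toFinset q.support.toFinset := by
    refine sum_le_sum fun u hu => ?_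
    have h4 := hq.ncard_neighborSet_toSubgraph_eq_two (List.mem_toFinset.1 hu)
    obtain ⟨a, b, hab, hset⟩ := Set.ncard_eq_two.1 h4
    have ha : q.toSubgraph.Adj u a := by
      have : a ∈ q.toSubgraph.neighborSet u := hset ▸ Set.mem_insert _ _
      exact this
    have hb : q.toSubgraph.Adj u b := by
      have : b ∈ q.toSubgraph.neighborSet u := hset ▸ Set.mem_insert_of_mem _ rfl
      exact this
    have hmem : ∀ z, q.toSubgraph.Adj u z → z ∈ q.support.toFinset := fun z hz =>
      List.mem_toFinset.2 (q.mem_verts_toSubgraph.1 hz.snd_mem)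
    have h5 := degIn_mono (G := G) (S := {a, b}) (T := q.support.toFinset)
      (by simp only [insert_subset_iff, singleton_subset_iff]; exact ⟨hmem a ha, hmem b hb⟩) u
    rw [degIn_pair hab, adjI_of_adj ha.adj_sub, adjI_of_adj hb.adj_sub] at h5
    exact h5
  rw [sum_const, nsmul_eq_mul] at h3
  linarith

lemma hasForestColoring_of_sparse [Fintype V] {D : ℕ} (hD : 2 ≤ D)
    (h : Sparse (D + 1 : ℤ) G (fun _ => (D + 1 : ℤ)) univ) : G.HasForestColoring D := by
  obtain ⟨M, F, hMF⟩ := colorable_of_sparse (k := (D + 1 : ℤ)) (by omega) _ G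
    (fun _ => (D + 1 : ℤ)) univ rfl (fun _ => ⟨by positivity, le_rfl⟩) h
  refine ⟨M, F, disjoint_coe.2 hMF.disj, ?_, hMF.forestM.isAcyclic, ?_, hMF.forestF.isAcyclic⟩
  · rw [← coe_union, hMF.union, coe_univ]
  · intro v
    have h1 := hMF.deg v v.2
    rw [encard_neighborSet_induce]
    exact_mod_cast (by omega : (degIn G M v).toNat ≤ D)

/-- Clearing the denominator 3(D + 1) turns one into the other; m = 2 is the sparse threshold and m
= 3 the extremal one. -/
lemma edges_bound_iff_pot {D : ℕ} (A : Finset V) (m : ℕ) :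
    -(m : ℤ) ≤ pot (D + 1 : ℤ) G (fun _ => (D + 1 : ℤ)) A ↔
      ((G.induce (A : Set V)).edgeSet.ncard : ℝ) ≤
        (6 * (D : ℝ) + 5) / (3 * ((D : ℝ) + 1)) * (A.card : ℝ) + m / (3 * ((D : ℝ) + 1)) := by
  have hpos : (0 : ℝ) < 3 * ((D : ℝ) + 1) := by positivity
  unfold pot
  rw [edgesIn_eq_ncard, div_mul_eq_mul_div, ← add_div, le_div_iff₀ hpos, sum_const, nsmul_eq_mul,
    ← Int.cast_le (R := ℝ)]
  push_cast
  constructor <;> intro h <;> linarith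

/-- Below 1/(D + 1) the potential exceeds -3, and being an integer it is at least -2. -/
lemma hasForestColoring_of_isABSparse {W : Type*} [Finite W] {H : SimpleGraph W} {D : ℕ}
    (hD : 2 ≤ D) {b : ℝ} (hb : b < 1 / ((D : ℝ) + 1))
    (h : H.IsABSparse ((6 * (D : ℝ) + 5) / (3 * ((D : ℝ) + 1))) b) : H.HasForestColoring D := by
  classical
  have := Fintype.ofFinite W
  refine hasForestColoring_of_sparse hD fun A _ => ?_
  by_cases hA : 2 ≤ A.card
  · have h1 : -(3 : ℤ) < pot (D + 1 : ℤ) H (fun _ => (D + 1 : ℤ)) A := by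
      have hpos : (0 : ℝ) < 3 * ((D : ℝ) + 1) := by positivity
      have h2 := h A hA
      have h3 : b * (3 * ((D : ℝ) + 1)) < 3 := by
        rw [lt_div_iff₀ (by positivity)] at hb
        linarith
      have h4 : (6 * (D : ℝ) + 5) / (3 * ((D : ℝ) + 1)) * (A.card : ℝ) * (3 * ((D : ℝ) + 1))
          = (6 * (D : ℝ) + 5) * A.card := by
        field_simp
      have h5 := mul_le_mul_of_nonneg_right h2 hpos.le
      rw [add_mul, h4] at h5
      unfold pot
      rw [edgesIn_eq_ncard, sum_const, nsmul_eq_mul, ← Int.cast_lt (R := ℝ)]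
      push_cast
      generalize ((H.induce (A : Set W)).edgeSet.ncard : ℝ) = e at *
      generalize (A.card : ℝ) = m at *
      generalize (D : ℝ) = d at *
      nlinarith
    linarith
  · have h1 : A.card = 0 ∨ A.card = 1 := by omega
    rcases h1 with h1 | h1
    · rw [card_eq_zero.1 h1, pot_empty]; norm_num
    · obtain ⟨v, rfl⟩ := card_eq_one.1 h1
      rw [pot_singleton]
      omega

end Bridge

/-! ### Weak colourings, whose absence is easier to propagate. -/

section WeakColoring

variable {V : Type*} [DecidableEq V]

/-- A split of `S` in which `F` is only required to contain no triangle and `M` only has to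
respect the capacities. -/
structure IsWeakColoring (G : SimpleGraph V) (c : V → ℤ) (S M F : Finset V) : Prop where
  union : M ∪ F = S
  deg : ∀ v ∈ M, degIn G M v + 1 ≤ c v
  triangle_free : ∀ x ∈ F, ∀ y ∈ F, ∀ z ∈ F, G.Adj x y → G.Adj x z → ¬ G.Adj y z

lemma two_mul_edgesIn_of_clique {G : SimpleGraph V} {Q : Finset V}
    (h : ∀ u ∈ Q, ∀ w ∈ Q, u ≠ w → G.Adj u w) :
    2 * edgesIn G Q = Q.card * (Q.card - 1) := by
  rw [two_mul_edgesIn]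
  unfold cross
  have h1 : ∀ u ∈ Q, degIn G Q u = (Q.card : ℤ) - 1 := by
    intro u hu
    rw [← degIn_erase_self]
    unfold degIn
    rw [sum_congr rfl fun w hw => adjI_of_adj (h u hu w (mem_of_mem_erase hw)
      (ne_of_mem_erase hw).symm)]
    have := card_erase_add_one hu
    simp only [sum_const, nsmul_eq_mul, mul_one]
    omega
  rw [sum_congr rfl h1, sum_const, nsmul_eq_mul]

end WeakColoring

/-- A graph on `{0, …, n - 1}` with potential `-3` that has no weak colouring, all whose proper
vertex subsets have potential at least `-2`. -/
structure Tight (k : ℤ) (n : ℕ) (G : SimpleGraph ℕ) (c : ℕ → ℤ) : Prop where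
  cap : ∀ v, 0 ≤ c v ∧ c v ≤ k
  pot_range : pot k G c (range n) = -3
  pot_proper : ∀ A ⊂ range n, -2 ≤ pot k G c A
  not_colorable : ¬ ∃ M F, IsWeakColoring G c (range n) M F

/-! ### Building tight uncolourable graphs by attaching triangles. -/

section AddTriangle

/-- The vertices from `n` on become a clique, and those with `l` are joined to `x`. -/
def addTriangle (G : SimpleGraph ℕ) (n x : ℕ) (l : ℕ → Prop) : SimpleGraph ℕ where
  Adj u w := u ≠ w ∧ ((u < n ∧ w < n ∧ G.Adj u w) ∨ (n ≤ u ∧ n ≤ w) ∨ (u = x ∧ n ≤ w ∧ l w) ∨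
    (w = x ∧ n ≤ u ∧ l u))
  symm := ⟨fun u w h => ⟨h.1.symm, by
    rcases h.2 with h | h | h | h
    · exact Or.inl ⟨h.2.1, h.1, h.2.2.symm⟩
    all_goals tauto⟩⟩
  loopless := ⟨fun _ h => h.1 rfl⟩

open scoped Classical in
/-- The capacities that go with `addTriangle`. -/
noncomputable def addTriangleCap (k : ℤ) (c : ℕ → ℤ) (n x : ℕ) (l : ℕ → Prop) (v : ℕ) : ℤ :=
  if v = x then c x + 1 else if v < n then c v else if l v then k else 0

variable {k : ℤ} {G : SimpleGraph ℕ} {c : ℕ → ℤ} {n x : ℕ} {l : ℕ → Prop}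

lemma addTriangle_adj_old {u w : ℕ} (hu : u < n) (hw : w < n) :
    (addTriangle G n x l).Adj u w ↔ G.Adj u w := by
  have h1 : ¬ n ≤ u := by omega
  have h2 : ¬ n ≤ w := by omega
  simp only [addTriangle, hu, hw, h1, h2, true_and, false_and, and_false, or_false]
  exact ⟨fun h => h.2, fun h => ⟨h.ne, h⟩⟩

lemma addTriangle_adj_new {u w : ℕ} (hu : n ≤ u) (hw : n ≤ w) (h : u ≠ w) :
    (addTriangle G n x l).Adj u w := ⟨h, Or.inr (Or.inl ⟨hu, hw⟩)⟩

lemma addTriangle_adj_mixed {u w : ℕ} (hu : n ≤ u) (hw : w < n) :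
    (addTriangle G n x l).Adj u w ↔ w = x ∧ l u := by
  have h1 : ¬ u < n := by omega
  have h2 : ¬ n ≤ w := by omega
  have h3 : u ≠ w := by omega
  simp [addTriangle, hu, h1, h2, h3]

lemma addTriangle_degIn_old {u : ℕ} {A : Finset ℕ} (hu : u < n) (hA : A ⊆ range n) :
    degIn (addTriangle G n x l) A u = degIn G A u :=
  sum_congr rfl fun _ hw => adjI_congr (addTriangle_adj_old hu (mem_range.1 (hA hw)))

lemma addTriangle_edgesIn_old {A : Finset ℕ} (hA : A ⊆ range n) :
    edgesIn (addTriangle G n x l) A = edgesIn G A := by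
  unfold edgesIn cross
  rw [sum_congr rfl fun u hu => addTriangle_degIn_old (mem_range.1 (hA hu)) hA]

lemma addTriangleCap_self : addTriangleCap k c n x l x = c x + 1 := if_pos rfl

lemma addTriangleCap_old {v : ℕ} (hv : v < n) (h : v ≠ x) : addTriangleCap k c n x l v = c v := by
  simp [addTriangleCap, hv, h]

lemma addTriangleCap_of_link (hx : x < n) {v : ℕ} (hv : n ≤ v) (h : l v) :
    addTriangleCap k c n x l v = k := by
  have h1 : ¬ v < n := by omega
  have h2 : v ≠ x := by omega
  simp [addTriangleCap, h1, h2, h]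

lemma addTriangleCap_of_not_link (hx : x < n) {v : ℕ} (hv : n ≤ v) (h : ¬ l v) :
    addTriangleCap k c n x l v = 0 := by
  have h1 : ¬ v < n := by omega
  have h2 : v ≠ x := by omega
  simp [addTriangleCap, h1, h2, h]

lemma addTriangle_pot_old {A : Finset ℕ} (hA : A ⊆ range n) :
    pot k (addTriangle G n x l) (addTriangleCap k c n x l) A =
      pot k G c A + if x ∈ A then 3 else 0 := by
  unfold pot
  rw [addTriangle_edgesIn_old hA]
  have h1 : ∀ v ∈ A, 3 * k - 1 + 3 * addTriangleCap k c n x l v =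
      (3 * k - 1 + 3 * c v) + if v = x then 3 else 0 := by
    intro v hv
    by_cases h : v = x
    · subst h; rw [addTriangleCap_self, if_pos rfl]; ring
    · rw [addTriangleCap_old (mem_range.1 (hA hv)) h, if_neg h]; ring
  rw [sum_congr rfl h1, sum_add_distrib, sum_ite_eq']
  ring

lemma addTriangle_degIn_new (hx : x < n) {q : ℕ} {A : Finset ℕ} (hq : n ≤ q)
    (hA : A ⊆ range n) (h : x ∈ A ∧ l q) : degIn (addTriangle G n x l) A q = 1 := by
  refine le_antisymm (degIn_le_one (x := x) fun u hu hadj => ?_) (one_le_degIn h.1 ?_)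
  · exact ((addTriangle_adj_mixed hq (mem_range.1 (hA hu))).1 hadj).1
  · exact (addTriangle_adj_mixed hq hx).2 ⟨rfl, h.2⟩

lemma addTriangle_degIn_new_eq_zero (hx : x < n) {q : ℕ} {A : Finset ℕ} (hq : n ≤ q)
    (hA : A ⊆ range n) (h : ¬ (x ∈ A ∧ l q)) : degIn (addTriangle G n x l) A q = 0 := by
  refine degIn_eq_zero fun u hu hadj => h ?_
  obtain ⟨rfl, hl⟩ := (addTriangle_adj_mixed hq (mem_range.1 (hA hu))).1 hadj
  exact ⟨hu, hl⟩

open scoped Classical in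
lemma addTriangle_pot (hx : x < n) {A Q : Finset ℕ} (hA : A ⊆ range n) (hQ : ∀ q ∈ Q, n ≤ q) :
    pot k (addTriangle G n x l) (addTriangleCap k c n x l) (Q ∪ A) =
      pot k G c A + (if x ∈ A then 3 else 3 * k * (Q.filter l).card) + (3 * k - 1) * Q.card
        - 3 * k * edgesIn (addTriangle G n x l) Q := by
  have hd : Disjoint Q A := disjoint_left.2 fun q hq hqA => by
    have := hQ q hq
    have := mem_range.1 (hA hqA)
    omega
  rw [pot_union hd, addTriangle_pot_old hA]
  unfold pot cross
  have h1 : ∑ v ∈ Q, (3 * k - 1 + 3 * addTriangleCap k c n x l v)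
      - 3 * k * ∑ v ∈ Q, degIn (addTriangle G n x l) A v
      = (3 * k - 1) * Q.card + if x ∈ A then 0 else 3 * k * (Q.filter l).card := by
    have hconst : (3 * k - 1) * (Q.card : ℤ) = ∑ _q ∈ Q, (3 * k - 1) := by
      rw [sum_const, nsmul_eq_mul, mul_comm]
    rw [mul_sum, ← sum_sub_distrib, hconst]
    by_cases hxA : x ∈ A
    · rw [if_pos hxA, add_zero]
      refine sum_congr rfl fun q hq => ?_
      by_cases hl : l q
      · rw [addTriangleCap_of_link hx (hQ q hq) hl,
          addTriangle_degIn_new hx (hQ q hq) hA ⟨hxA, hl⟩]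
        ring
      · rw [addTriangleCap_of_not_link hx (hQ q hq) hl,
          addTriangle_degIn_new_eq_zero hx (hQ q hq) hA fun h => hl h.2]
        ring
    · rw [if_neg hxA, card_filter, Nat.cast_sum, mul_sum, ← sum_add_distrib]
      refine sum_congr rfl fun q hq => ?_
      rw [addTriangle_degIn_new_eq_zero hx (hQ q hq) hA fun h => hxA h.1]
      by_cases hl : l q
      · rw [addTriangleCap_of_link hx (hQ q hq) hl, if_pos hl]
        push_cast
        ring
      · rw [addTriangleCap_of_not_link hx (hQ q hq) hl, if_neg hl]
        push_cast
        ring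
  split_ifs at h1 ⊢ <;> linarith

/-- The extra unit at x adds 3, and the new triangle takes 3 away: each link edge cancels the
capacity k of its new end. In a weak colouring some new vertex is in M; it has positive capacity,
hence is joined to x, so restricting to the old vertices respects the old capacity of x. -/
lemma Tight.addTriangle (hk : 1 ≤ k) (h : Tight k n G c) (hx : x < n) (hcx : c x < k)
    (hl : l n) : Tight k (n + 3) (addTriangle G n x l) (addTriangleCap k c n x l) := by
  classical
  have hsplit : ∀ B ⊆ range (n + 3), ∃ A Q, A ⊆ range n ∧ Q ⊆ {n, n + 1, n + 2} ∧ B = Q ∪ A := by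
    intro B hB
    refine ⟨B ∩ range n, B ∩ {n, n + 1, n + 2}, inter_subset_right, inter_subset_right, ?_⟩
    ext v
    have : v ∈ B → v < n + 3 := fun h => mem_range.1 (hB h)
    simp only [mem_union, mem_inter, mem_range, mem_insert, mem_singleton]
    constructor
    · intro hv
      have := this hv
      by_cases h' : v < n
      · exact Or.inr ⟨hv, h'⟩
      · exact Or.inl ⟨hv, by omega⟩
    · rintro (h | h) <;> exact h.1
  have hnew : ∀ Q : Finset ℕ, Q ⊆ {n, n + 1, n + 2} → ∀ q ∈ Q, n ≤ q := by
    intro Q hQ q hq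
    have := hQ hq
    simp only [mem_insert, mem_singleton] at this
    omega
  have hrange : range (n + 3) = {n, n + 1, n + 2} ∪ range n := by
    ext v
    simp only [mem_union, mem_range, mem_insert, mem_singleton]
    omega
  have hcard3 : ({n, n + 1, n + 2} : Finset ℕ).card = 3 := by
    rw [card_insert_of_notMem (by simp), card_pair (by omega)]
  have hedges : ∀ Q : Finset ℕ, Q ⊆ {n, n + 1, n + 2} →
      2 * edgesIn (ForestColoring.addTriangle G n x l) Q = Q.card * (Q.card - 1) := fun Q hQ =>
    two_mul_edgesIn_of_clique fun u hu w hw huw =>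
      addTriangle_adj_new (hnew Q hQ u hu) (hnew Q hQ w hw) huw
  refine ⟨?_, ?_, ?_, ?_⟩
  · intro v
    have h1 := h.cap v
    have h2 := h.cap x
    simp only [addTriangleCap]
    split_ifs <;> omega
  · rw [hrange, addTriangle_pot hx Subset.rfl (hnew _ Subset.rfl), h.pot_range,
      if_pos (mem_range.2 hx)]
    have := hedges _ Subset.rfl
    rw [hcard3] at this ⊢
    push_cast at this ⊢
    have h3 : edgesIn (ForestColoring.addTriangle G n x l) {n, n + 1, n + 2} = 3 := by linarith
    rw [h3]
    ring
  · intro B hB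
    obtain ⟨A, Q, hA, hQ, rfl⟩ := hsplit B hB.1
    rw [addTriangle_pot hx hA (hnew Q hQ)]
    have hE := hedges Q hQ
    have hle : Q.card ≤ 3 := hcard3 ▸ card_le_card hQ
    have hfull : Q.card = 3 → Q = {n, n + 1, n + 2} := fun h =>
      eq_of_subset_of_card_le hQ (by rw [hcard3, h])
    have hpotA : A ≠ range n → -2 ≤ pot k G c A := fun hne =>
      h.pot_proper A (hA.ssubset_of_ne hne)
    have hpotA' : -3 ≤ pot k G c A := by
      by_cases hAr : A = range n
      · rw [hAr, h.pot_range]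
      · linarith [hpotA hAr]
    have hfil : (0 : ℤ) ≤ 3 * k * (Q.filter l).card := by positivity
    have hsmall : Q.card ≠ 3 → 0 ≤ (3 * k - 1) * Q.card
        - 3 * k * edgesIn (ForestColoring.addTriangle G n x l) Q := by
      intro hne
      have : Q.card = 0 ∨ Q.card = 1 ∨ Q.card = 2 := by omega
      rcases this with h0 | h0 | h0 <;> rw [h0] at hE ⊢ <;> push_cast at hE ⊢
      · rw [show edgesIn (ForestColoring.addTriangle G n x l) Q = 0 by linarith]; simp
      · rw [show edgesIn (ForestColoring.addTriangle G n x l) Q = 0 by linarith]; linarith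
      · rw [show edgesIn (ForestColoring.addTriangle G n x l) Q = 1 by linarith]; linarith
    by_cases h3 : Q.card = 3
    · have hQe := hfull h3
      have hAr : A ≠ range n := fun hAr => hB.ne (by rw [hAr, hQe, hrange])
      have hpA := hpotA hAr
      rw [h3] at hE ⊢
      push_cast at hE ⊢
      rw [show edgesIn (ForestColoring.addTriangle G n x l) Q = 3 by linarith]
      -- If x is not in A, the unused capacity of a linked vertex compensates for the -3 of the
      -- triangle.
      have hf1 : 1 ≤ (Q.filter l).card :=
        card_pos.2 ⟨n, mem_filter.2 ⟨hQe ▸ mem_insert_self _ _, hl⟩⟩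
      have hf2 : (1 : ℤ) ≤ (Q.filter l).card := by exact_mod_cast hf1
      split_ifs
      · linarith
      · nlinarith
    · have hs := hsmall h3
      split_ifs with hxA
      · linarith
      · have := hpotA fun hAr => hxA (hAr ▸ mem_range.2 hx)
        linarith
  · rintro ⟨M, F, hMF⟩
    have hmem : ∀ v < n + 3, v ∈ M ∨ v ∈ F := fun v hv =>
      mem_union.1 (hMF.union ▸ mem_range.2 hv)
    obtain ⟨q, hqM, hq⟩ : ∃ q ∈ M, n ≤ q := by
      by_contra! hcon
      have hF : ∀ v, n ≤ v → v < n + 3 → v ∈ F := fun v h1 h2 =>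
        (hmem v h2).resolve_left fun hv => absurd (hcon v hv) (by omega)
      exact hMF.triangle_free n (hF n le_rfl (by omega)) (n + 1) (hF _ (by omega) (by omega))
        (n + 2) (hF _ (by omega) (by omega)) (addTriangle_adj_new le_rfl (by omega) (by omega))
        (addTriangle_adj_new le_rfl (by omega) (by omega))
        (addTriangle_adj_new (by omega) (by omega) (by omega))
    have hlq : l q := by
      by_contra hlq
      have h1 := hMF.deg q hqM
      rw [addTriangleCap_of_not_link hx hq hlq] at h1
      linarith [degIn_nonneg (G := ForestColoring.addTriangle G n x l) M q]
    refine h.not_colorable ⟨M ∩ range n, F ∩ range n, ?_, ?_, ?_⟩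
    · rw [← union_inter_distrib_right, hMF.union]
      exact inter_eq_right.2 (range_subset_range.2 (by omega))
    · intro v hv
      obtain ⟨hvM, hvn⟩ := mem_inter.1 hv
      rw [mem_range] at hvn
      have h1 := hMF.deg v hvM
      rw [← addTriangle_degIn_old (G := G) (x := x) (l := l) hvn
        (inter_subset_right (s₁ := M) (s₂ := range n))]
      by_cases hvx : v = x
      · subst hvx
        rw [addTriangleCap_self] at h1
        have hqn : q ∉ M ∩ range n := fun h => by
          have := mem_range.1 (mem_inter.1 h).2
          omega
        have h2 := degIn_mono (G := ForestColoring.addTriangle G n v l)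
          (S := {q} ∪ M ∩ range n) (T := M)
          (union_subset (singleton_subset_iff.2 hqM) inter_subset_left) v
        rw [degIn_union (disjoint_singleton_left.2 hqn), degIn_singleton,
          adjI_of_adj ((addTriangle_adj_mixed hq hx).2 ⟨rfl, hlq⟩).symm] at h2
        linarith
      · rw [addTriangleCap_old hvn hvx] at h1
        linarith [degIn_mono (G := ForestColoring.addTriangle G n x l)
          (inter_subset_left (s₁ := M) (s₂ := range n)) v]
    · intro a ha b hb d hd hab had hbd
      obtain ⟨ha, ha'⟩ := mem_inter.1 ha
      obtain ⟨hb, hb'⟩ := mem_inter.1 hb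
      obtain ⟨hd, hd'⟩ := mem_inter.1 hd
      rw [mem_range] at ha' hb' hd'
      exact hMF.triangle_free a ha b hb d hd ((addTriangle_adj_old ha' hb').2 hab)
        ((addTriangle_adj_old ha' hd').2 had) ((addTriangle_adj_old hb' hd').2 hbd)

lemma tight_triangle (hk : 1 ≤ k) : Tight k 3 ⊤ (fun _ => 0) := by
  have hE : ∀ A : Finset ℕ, 2 * edgesIn (⊤ : SimpleGraph ℕ) A = A.card * (A.card - 1) := fun A =>
    two_mul_edgesIn_of_clique fun _ _ _ _ h => h
  have hpot : ∀ A : Finset ℕ, pot k ⊤ (fun _ => 0) A =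
      (3 * k - 1) * A.card - 3 * k * edgesIn (⊤ : SimpleGraph ℕ) A := fun A => by
    unfold pot
    rw [sum_const, nsmul_eq_mul]
    ring
  refine ⟨fun _ => ⟨le_rfl, by linarith⟩, ?_, ?_, ?_⟩
  · have h1 := hE (range 3)
    rw [hpot]
    rw [card_range] at h1 ⊢
    push_cast at h1 ⊢
    rw [show edgesIn (⊤ : SimpleGraph ℕ) (range 3) = 3 by linarith]
    ring
  · intro A hA
    have h1 := hE A
    have h2 := card_lt_card hA
    rw [card_range] at h2
    rw [hpot]
    have : A.card = 0 ∨ A.card = 1 ∨ A.card = 2 := by omega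
    rcases this with h0 | h0 | h0 <;> rw [h0] at h1 ⊢ <;> push_cast at h1 ⊢
    · rw [show edgesIn (⊤ : SimpleGraph ℕ) A = 0 by linarith]; norm_num
    · rw [show edgesIn (⊤ : SimpleGraph ℕ) A = 0 by linarith]; linarith
    · rw [show edgesIn (⊤ : SimpleGraph ℕ) A = 1 by linarith]; linarith
  · rintro ⟨M, F, h⟩
    have hF : ∀ v < 3, v ∈ F := fun v hv => by
      refine (mem_union.1 (h.union ▸ mem_range.2 hv)).resolve_left fun hM => ?_
      linarith [h.deg v hM, degIn_nonneg (G := ⊤) M v]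
    exact h.triangle_free 0 (hF 0 (by norm_num)) 1 (hF 1 (by norm_num)) 2 (hF 2 (by norm_num))
      (by simp) (by simp) (by simp)

/-- Linking only one new vertex leaves two of capacity 0, so the growth can always continue. -/
lemma exists_tight_of_le (hk : 1 ≤ k) (N : ℕ) :
    ∃ n G c, N ≤ n ∧ Tight k n G c ∧ ∃ x < n, c x < k := by
  induction N with
  | zero => exact ⟨3, ⊤, fun _ => 0, by omega, tight_triangle hk, 0, by omega, by linarith⟩
  | succ N ih =>
    obtain ⟨n, G, c, hN, h, x, hx, hcx⟩ := ih
    refine ⟨n + 3, _, _, by omega, h.addTriangle (l := fun w => w = n) hk hx hcx rfl, n + 1,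
      by omega, ?_⟩
    rw [addTriangleCap_of_not_link hx (by omega) (by omega)]
    linarith

/-- When all three new vertices are linked, they have full capacity and the total deficit drops by
exactly one. -/
lemma Tight.exists_full (hk : 1 ≤ k) (d : ℕ) : ∀ n G c, Tight k n G c →
    ∑ v ∈ range n, (k - c v) = d → ∃ n' G' c', n ≤ n' ∧ Tight k n' G' c' ∧ ∀ v < n', c' v = k := by
  induction d with
  | zero =>
    intro n G c h hd
    refine ⟨n, G, c, le_rfl, h, fun v hv => ?_⟩
    have := (sum_eq_zero_iff_of_nonneg fun v _ => sub_nonneg.2 (h.cap v).2).1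
      (by exact_mod_cast hd) v (mem_range.2 hv)
    linarith
  | succ d ih =>
    intro n G c h hd
    obtain ⟨x, hx, hcx⟩ : ∃ x < n, c x < k := by
      by_contra! hcon
      have : ∑ v ∈ range n, (k - c v) ≤ 0 :=
        sum_nonpos fun v hv => by linarith [hcon v (mem_range.1 hv)]
      push_cast at hd
      linarith
    have hsum : ∑ v ∈ range (n + 3), (k - addTriangleCap k c n x (fun _ => True) v) = d := by
      have hnew : ∀ v, n ≤ v → k - addTriangleCap k c n x (fun _ => True) v = 0 := fun v hv => by
        rw [addTriangleCap_of_link hx hv trivial, sub_self]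
      have hold : ∀ v ∈ range n, k - addTriangleCap k c n x (fun _ => True) v
          = (k - c v) - if v = x then 1 else 0 := fun v hv => by
        by_cases hvx : v = x
        · subst hvx; rw [addTriangleCap_self, if_pos rfl]; ring
        · rw [addTriangleCap_old (mem_range.1 hv) hvx, if_neg hvx, sub_zero]
      rw [sum_range_succ, sum_range_succ, sum_range_succ, hnew _ le_rfl, hnew _ (by omega),
        hnew _ (by omega), sum_congr rfl hold, sum_sub_distrib, hd, sum_ite_eq',
        if_pos (mem_range.2 hx)]
      push_cast
      ring
    obtain ⟨n', G', c', hn, h'⟩ := ih _ _ _ (h.addTriangle hk hx hcx trivial) hsum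
    exact ⟨n', G', c', by omega, h'⟩

lemma exists_full_tight (hk : 1 ≤ k) (N : ℕ) :
    ∃ n G c, N ≤ n ∧ Tight k n G c ∧ ∀ v < n, c v = k := by
  obtain ⟨n, G, c, hN, h, -⟩ := exists_tight_of_le hk N
  have hnn : 0 ≤ ∑ v ∈ range n, (k - c v) := sum_nonneg fun v _ => by linarith [(h.cap v).2]
  obtain ⟨n', G', c', hn, h'⟩ := Tight.exists_full hk _ n G c h (Int.toNat_of_nonneg hnn).symm
  exact ⟨n', G', c', hN.trans hn, h'⟩

end AddTriangle

/-! ### Moving the extremal graphs to arbitrary finite types. -/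

section Transfer

variable {W : Type*} [Fintype W] [DecidableEq W] {G : SimpleGraph ℕ} (f : W ↪ ℕ)

lemma degIn_comap (A : Finset W) (w : W) :
    degIn (G.comap f) A w = degIn G (A.map f) (f w) := by
  unfold degIn
  rw [sum_map]
  exact sum_congr rfl fun _ _ => adjI_congr Iff.rfl

lemma edgesIn_comap (A : Finset W) : edgesIn (G.comap f) A = edgesIn G (A.map f) := by
  unfold edgesIn cross
  rw [sum_map, sum_congr rfl fun w _ => degIn_comap f A w]

lemma pot_comap {k : ℤ} {c : ℕ → ℤ} (A : Finset W) :
    pot k (G.comap f) (c ∘ f) A = pot k G c (A.map f) := by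
  unfold pot
  rw [edgesIn_comap, sum_map]
  rfl

lemma exists_weakColoring_of_hasForestColoring {n D : ℕ} {c : ℕ → ℤ}
    (hf : univ.map f = range n) (hc : ∀ v < n, c v = D + 1)
    (h : (G.comap f).HasForestColoring D) : ∃ M F, IsWeakColoring G c (range n) M F := by
  classical
  obtain ⟨M, F, hMF⟩ := h
  refine ⟨M.toFinset.map f, F.toFinset.map f, ?_, ?_, ?_⟩
  · rw [← map_union, ← hf, ← Set.toFinset_union, ← Set.toFinset_univ]
    congr 1
    rw [Set.toFinset_inj]
    exact hMF.union_eq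
  · intro v hv
    have hvn : v < n := by
      rw [← mem_range, ← hf]
      exact map_subset_map.2 (subset_univ _) hv
    obtain ⟨w, hw, rfl⟩ := mem_map.1 hv
    rw [← degIn_comap, hc _ hvn]
    have h1 : ∀ u ∈ M.toFinset, (((G.comap f).induce (M.toFinset : Set W)).neighborSet
        ⟨w, hw⟩).encard ≤ (D : ℕ∞) := by
      intro _ _
      have h2 := hMF.degree_le ⟨w, Set.mem_toFinset.1 hw⟩
      have h3 : (M.toFinset : Set W) = M := Set.coe_toFinset M
      convert h2
    have h2 := h1 w hw
    rw [encard_neighborSet_induce] at h2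
    have h3 : (degIn (G.comap f) M.toFinset w).toNat ≤ D := by exact_mod_cast h2
    omega
  · intro x hx y hy z hz hxy hxz hyz
    obtain ⟨x, hx', rfl⟩ := mem_map.1 hx
    obtain ⟨y, hy', rfl⟩ := mem_map.1 hy
    obtain ⟨z, hz', rfl⟩ := mem_map.1 hz
    rw [Set.mem_toFinset] at hx' hy' hz'
    have h3 : ((G.comap f).induce F).IsNClique 3
        {(⟨x, hx'⟩ : F), (⟨y, hy'⟩ : F), (⟨z, hz'⟩ : F)} :=
      SimpleGraph.is3Clique_triple_iff.2 ⟨hxy, hxz, hyz⟩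
    obtain ⟨u, p, hp, -⟩ := SimpleGraph.is3Clique_iff_exists_cycle_length_three.1 ⟨_, h3⟩
    exact hMF.forest_right p hp

/-- Arbitrarily large uncolourable graphs that violate the bound on the number of edges by the
least possible amount, and only on the full vertex set. -/
lemma exists_extremal (D N : ℕ) : ∃ n, N ≤ n ∧ ∀ (W : Type*) [Fintype W] [DecidableEq W]
    (f : W ↪ ℕ), univ.map f = range n → ∃ G : SimpleGraph W,
      pot (D + 1 : ℤ) G (fun _ => (D + 1 : ℤ)) univ = -3 ∧
      (∀ A ⊂ (univ : Finset W), -2 ≤ pot (D + 1 : ℤ) G (fun _ => (D + 1 : ℤ)) A) ∧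
      ¬ G.HasForestColoring D := by
  obtain ⟨n, G, c, hN, h, hc⟩ := exists_full_tight (k := (D + 1 : ℤ)) (by omega) N
  refine ⟨n, hN, fun W _ _ f hf => ⟨G.comap f, ?_⟩⟩
  have hcf : c ∘ f = fun _ => (D + 1 : ℤ) := by
    funext w
    refine hc _ (mem_range.1 ?_)
    rw [← hf]
    exact mem_map_of_mem f (mem_univ w)
  rw [← hcf]
  refine ⟨?_, fun A hA => ?_, fun hcol => ?_⟩
  · rw [pot_comap, hf, h.pot_range]
  · rw [pot_comap]
    exact h.pot_proper _ (hf ▸ map_ssubset_map.2 hA)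
  · exact h.not_colorable (exists_weakColoring_of_hasForestColoring f hf hc hcol)

end Transfer

end ForestColoring

/-! ### Colourability, exactness and extremal graphs combined. -/

theorem mainTheorem6 (D : ℕ) (hD : 2 ≤ D) :
    -- every sparse graph is colorable
    (∀ (V : Type u) [Finite V] (G : SimpleGraph V),
      G.IsABSparse ((6 * (D : ℝ) + 5) / (3 * ((D : ℝ) + 1))) (2 / (3 * ((D : ℝ) + 1))) →
        G.HasForestColoring D) ∧
    -- neither parameter can be relaxed (`2 / (3 (D + 1)) ≤ b < 1 / (D + 1)` all give the same class)
    (∀ a b : ℝ, (6 * (D : ℝ) + 5) / (3 * ((D : ℝ) + 1)) ≤ a → 2 / (3 * ((D : ℝ) + 1)) ≤ b →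
      ((∀ (V : Type u) [Finite V] (G : SimpleGraph V), G.IsABSparse a b → G.HasForestColoring D) ↔
        (a = (6 * (D : ℝ) + 5) / (3 * ((D : ℝ) + 1)) ∧ b < 1 / ((D : ℝ) + 1)))) ∧
    -- arbitrarily large non-colorable graphs that exceed the bound by the least possible amount
    (∀ N : ℕ, ∃ n : ℕ, N ≤ n ∧ ∃ G : SimpleGraph (Fin n),
      G.IsABSparse ((6 * (D : ℝ) + 5) / (3 * ((D : ℝ) + 1))) (1 / ((D : ℝ) + 1)) ∧
      (G.edgeSet.ncard : ℝ) =
        (6 * (D : ℝ) + 5) / (3 * ((D : ℝ) + 1)) * (n : ℝ) + 1 / ((D : ℝ) + 1) ∧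
      ¬ G.HasForestColoring D) := by
  classical
  have hthree : (3 : ℝ) / (3 * ((D : ℝ) + 1)) = 1 / ((D : ℝ) + 1) := by
    field_simp
  have hpos : (0 : ℝ) < 3 * ((D : ℝ) + 1) := by positivity
  refine ⟨fun V _ G hG => ?_, fun a b ha hb => ⟨fun h => ?_, ?_⟩, fun N => ?_⟩
  · exact ForestColoring.hasForestColoring_of_isABSparse hD (by rw [← hthree]; gcongr; norm_num) hG
  · by_contra hcon
    -- Past N, the relaxed bound admits the full vertex set of an extremal graph. For a larger slope
    -- this takes many vertices, as b may still be below 1/(D + 1).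
    obtain ⟨N, hN⟩ : ∃ N : ℕ, ∀ n : ℕ, N ≤ n →
        (6 * (D : ℝ) + 5) / (3 * ((D : ℝ) + 1)) * n + 3 / (3 * ((D : ℝ) + 1)) ≤ a * n + b := by
      rcases ha.eq_or_lt with rfl | ha
      · refine ⟨0, fun n _ => ?_⟩
        have : 1 / ((D : ℝ) + 1) ≤ b := not_lt.1 fun hb' => hcon ⟨rfl, hb'⟩
        linarith
      · obtain ⟨N, hN⟩ := exists_nat_ge
          ((3 / (3 * ((D : ℝ) + 1)) - b) / (a - (6 * (D : ℝ) + 5) / (3 * ((D : ℝ) + 1))))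
        refine ⟨N, fun n hn => ?_⟩
        have h1 : (N : ℝ) ≤ n := by exact_mod_cast hn
        have h2 := hN.trans h1
        rw [div_le_iff₀ (by linarith)] at h2
        linarith
    obtain ⟨n, hn, hW⟩ := ForestColoring.exists_extremal.{u} D N
    let f : ULift.{u} (Fin n) ↪ ℕ := Equiv.ulift.toEmbedding.trans Fin.valEmbedding
    have hf : Finset.univ.map f = Finset.range n := by
      ext v
      simp only [Finset.mem_map, Finset.mem_univ, true_and, Finset.mem_range]
      exact ⟨fun ⟨w, hw⟩ => hw ▸ w.down.2, fun hv => ⟨⟨⟨v, hv⟩⟩, rfl⟩⟩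
    obtain ⟨G, h1, h2, h3⟩ := hW _ f hf
    refine h3 (h _ G fun A _ => ?_)
    by_cases hA : A = Finset.univ
    · subst hA
      have h4 := (ForestColoring.edges_bound_iff_pot (G := G) (D := D) Finset.univ 3).1
        (by rw [h1]; norm_num)
      refine h4.trans ?_
      rw [show (Finset.univ : Finset (ULift.{u} (Fin n))).card = n by simp]
      exact_mod_cast hN n hn
    -- Proper subsets satisfy the original bound, and both parameters only grew.
    · have h4 := (ForestColoring.edges_bound_iff_pot (G := G) (D := D) A 2).1
        (by exact_mod_cast h2 A (Finset.ssubset_univ_iff.2 hA))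
      refine h4.trans ?_
      push_cast
      gcongr
  · rintro ⟨rfl, hb'⟩ V _ G hG
    exact ForestColoring.hasForestColoring_of_isABSparse hD hb' hG
  · obtain ⟨n, hn, hW⟩ := ForestColoring.exists_extremal.{0} D N
    have hf : (Finset.univ : Finset (Fin n)).map Fin.valEmbedding = Finset.range n := by
      ext v
      simp only [Finset.mem_map, Finset.mem_univ, true_and, Finset.mem_range]
      exact ⟨fun ⟨w, hw⟩ => hw ▸ w.2, fun hv => ⟨⟨v, hv⟩, rfl⟩⟩
    obtain ⟨G, h1, h2, h3⟩ := hW _ Fin.valEmbedding hf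
    refine ⟨n, hn, G, fun A _ => ?_, ?_, h3⟩
    · rw [← hthree]
      refine (ForestColoring.edges_bound_iff_pot (G := G) (D := D) A 3).1 ?_
      by_cases hA : A = Finset.univ
      · rw [hA, h1]; norm_num
      · have := h2 A (Finset.ssubset_univ_iff.2 hA)
        push_cast
        linarith
    · rw [← hthree, div_mul_eq_mul_div, ← add_div, eq_div_iff hpos.ne']
      have hE := ForestColoring.edgesIn_eq_ncard (G := G) Finset.univ
      have hiso : (G.induce ((Finset.univ : Finset (Fin n)) : Set (Fin n))).edgeSet.ncard
          = G.edgeSet.ncard := by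
        rw [Finset.coe_univ]
        exact Set.ncard_congr' (SimpleGraph.induceUnivIso G).mapEdgeSet
      rw [hiso] at hE
      unfold ForestColoring.pot at h1
      rw [hE, Finset.sum_const, nsmul_eq_mul, Finset.card_univ, Fintype.card_fin] at h1
      have h4 : ((n * (3 * (D + 1 : ℤ) - 1 + 3 * (D + 1 : ℤ))
          - 3 * (D + 1 : ℤ) * (G.edgeSet.ncard : ℤ) : ℤ) : ℝ) = ((-3 : ℤ) : ℝ) := by rw [h1]
      push_cast at h4
      linarith
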